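/- Let $B=\{x\in\mathbb{R}^2 : |x|\le 1\}$ and $B^c=\mathbb{R}^2\setminus B$; all functions are real-valued. Let $\Delta_{B^c}$ be the Dirichlet Laplacian in $L^2(B^c)$ with domain $D(\Delta_{B^c})=H^2(B^c)\cap H^1_0(B^c)$, and let $(e^{t\mathcal L})_{t\ge 0}$ be the $C_0$-semigroup on $H^1_0(B^c)\times L^2(B^c)$ generated by $$\mathcal L(u,v)=(v,\ \Delta_{B^c}u-v),\qquad D(\mathcal L)=D(\Delta_{B^c})\times H^1_0(B^c).$$ For $g\in L^2(B^c)$ put $S(t)g=P_1e^{t\mathcal L}(0,g)$, where $P_1(u,v)=u$; that is, $u(t)=S(t)g$ is the solution of the linear damped wave equation $$\partial_t^2u-\Delta u+\partial_tu=0\ \text{ in } B^c\times(0,\infty),\qquad u=0\ \text{ on } \partial B^c\times(0,\infty),\qquad (u,\partial_tu)(\cdot,0)=(0,g).$$ If $g\in L^2(B^c)$ is radially symmetric and nonnegative (almost everywhere), then for every $t>0$ the function $S(t)g$ is radially symmetric and nonnegative (almost everywhere) in $B^c$. -/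

import Mathlib

open MeasureTheory Filter Topology
open scoped NNReal ContDiff

noncomputable section

namespace DampedWave

/-- `ℝ^N` with its Euclidean norm. -/
abbrev E (N : ℕ) : Type := EuclideanSpace ℝ (Fin N)

/-- The real Hilbert space `L²(Ω)` with respect to Lebesgue measure. -/
abbrev L2 {N : ℕ} (Ω : Set (E N)) : Type := Lp ℝ 2 ((volume : Measure (E N)).restrict Ω)

/-- The classical partial derivative `∂ᵢ φ`. -/
def partialDeriv {N : ℕ} (i : Fin N) (φ : E N → ℝ) (x : E N) : ℝ :=
  fderiv ℝ φ x (EuclideanSpace.single i 1)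

/-- `φ ∈ C_c^∞(Ω)`. -/
structure IsTestFunction {N : ℕ} (Ω : Set (E N)) (φ : E N → ℝ) : Prop where
  smooth : ContDiff ℝ ∞ φ
  compact : HasCompactSupport φ
  supp : tsupport φ ⊆ Ω

theorem IsTestFunction.zero {N : ℕ} (Ω : Set (E N)) : IsTestFunction Ω (0 : E N → ℝ) where
  smooth := contDiff_const
  compact := HasCompactSupport.zero
  supp := by simp [tsupport]

theorem IsTestFunction.add {N : ℕ} {Ω : Set (E N)} {φ ψ : E N → ℝ}
    (hφ : IsTestFunction Ω φ) (hψ : IsTestFunction Ω ψ) : IsTestFunction Ω (φ + ψ) where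
  smooth := hφ.smooth.add hψ.smooth
  compact := hφ.compact.add hψ.compact
  supp := (tsupport_add φ ψ).trans (Set.union_subset hφ.supp hψ.supp)

theorem IsTestFunction.smul {N : ℕ} {Ω : Set (E N)} {φ : E N → ℝ}
    (c : ℝ) (hφ : IsTestFunction Ω φ) : IsTestFunction Ω (c • φ) where
  smooth := hφ.smooth.const_smul c
  compact := hφ.compact.smul_left (f := fun _ => c)
  supp := (tsupport_smul_subset_right (fun _ => c) φ).trans hφ.supp

theorem IsTestFunction.differentiableAt {N : ℕ} {Ω : Set (E N)} {φ : E N → ℝ}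
    (hφ : IsTestFunction Ω φ) (x : E N) : DifferentiableAt ℝ φ x :=
  hφ.smooth.differentiable (by simp) x

/-- `v ∈ L²(Ω)` is the weak partial derivative `∂ᵢ u` of `u ∈ L²(Ω)`. -/
def IsWeakDeriv {N : ℕ} (Ω : Set (E N)) (i : Fin N) (u v : L2 Ω) : Prop :=
  ∀ φ : E N → ℝ, IsTestFunction Ω φ →
    ∫ x in Ω, u x * partialDeriv i φ x = - ∫ x in Ω, v x * φ x

/-- `u ∈ H²(Ω)` (all weak derivatives of order at most two are in `L²(Ω)`), and `Δ u = w`. -/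
def IsH2WithLaplacian {N : ℕ} (Ω : Set (E N)) (u w : L2 Ω) : Prop :=
  ∃ (p : Fin N → L2 Ω) (q : Fin N → Fin N → L2 Ω),
    (∀ i, IsWeakDeriv Ω i u (p i)) ∧ (∀ i j, IsWeakDeriv Ω j (p i) (q i j)) ∧ w = ∑ i, q i i

/-- The space `C_c^∞(Ω)`, each function `φ` being recorded as the pair `(φ, ∇φ)` in
`L²(Ω) × L²(Ω)^N`. The norm induced on such pairs is equivalent to the `H¹(Ω)` norm. -/
def testPairs {N : ℕ} (Ω : Set (E N)) : Submodule ℝ (L2 Ω × (Fin N → L2 Ω)) where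
  carrier := {u | ∃ φ : E N → ℝ, IsTestFunction Ω φ ∧
    (u.1 : E N → ℝ) =ᵐ[volume.restrict Ω] φ ∧
    ∀ i, (u.2 i : E N → ℝ) =ᵐ[volume.restrict Ω] partialDeriv i φ}
  zero_mem' := by
    refine ⟨0, IsTestFunction.zero Ω, Lp.coeFn_zero _ _ _, fun i => ?_⟩
    have h : partialDeriv i (0 : E N → ℝ) = 0 := by
      funext x
      simp [partialDeriv]
    rw [h]
    exact Lp.coeFn_zero _ _ _
  add_mem' := by
    rintro u v ⟨φ, hφ, hu, hu'⟩ ⟨ψ, hψ, hv, hv'⟩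
    refine ⟨φ + ψ, hφ.add hψ, (Lp.coeFn_add _ _).trans (hu.add hv), fun i => ?_⟩
    have h : partialDeriv i (φ + ψ) = partialDeriv i φ + partialDeriv i ψ := by
      funext x
      simp [partialDeriv, fderiv_add (hφ.differentiableAt x) (hψ.differentiableAt x)]
    rw [h]
    exact (Lp.coeFn_add _ _).trans ((hu' i).add (hv' i))
  smul_mem' := by
    rintro c u ⟨φ, hφ, hu, hu'⟩
    refine ⟨c • φ, hφ.smul c, (Lp.coeFn_smul _ _).trans (hu.const_smul c), fun i => ?_⟩
    have h : partialDeriv i (c • φ) = c • partialDeriv i φ := by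
      funext x
      simp [partialDeriv, fderiv_const_smul (hφ.differentiableAt x)]
    rw [h]
    exact (Lp.coeFn_smul _ _).trans ((hu' i).const_smul c)

/-- `H¹₀(Ω)`, the closure of `C_c^∞(Ω)` in the `H¹` norm. An element is a pair `(u, ∇u)`, where
`∇u` is the weak gradient of `u` (hence determined by `u`). -/
abbrev H10 {N : ℕ} (Ω : Set (E N)) : Submodule ℝ (L2 Ω × (Fin N → L2 Ω)) :=
  (testPairs Ω).topologicalClosure

/-- The inclusion `H¹₀(Ω) → L²(Ω)`. -/
def toL2 {N : ℕ} {Ω : Set (E N)} (u : H10 Ω) : L2 Ω := (u : L2 Ω × (Fin N → L2 Ω)).1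

/-- The space `H¹₀(Ω) × L²(Ω)`. -/
abbrev EnergySpace {N : ℕ} (Ω : Set (E N)) : Type := H10 Ω × L2 Ω

/-- The graph of the operator `(u, v) ↦ (v, Δu - v)` in `H¹₀(Ω) × L²(Ω)`, with domain
`(H²(Ω) ∩ H¹₀(Ω)) × H¹₀(Ω)`: `X = (u, v)` is in the domain and is mapped to `Y`. -/
def DampedWaveGraph {N : ℕ} (Ω : Set (E N)) (X Y : EnergySpace Ω) : Prop :=
  toL2 Y.1 = X.2 ∧ ∃ w : L2 Ω, IsH2WithLaplacian Ω (toL2 X.1) w ∧ Y.2 = w - X.2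

/-- A `C₀`-semigroup of bounded linear operators on a normed space. -/
structure IsC0Semigroup {X : Type*} [NormedAddCommGroup X] [NormedSpace ℝ X]
    (T : ℝ≥0 → X →L[ℝ] X) : Prop where
  map_zero : T 0 = ContinuousLinearMap.id ℝ X
  map_add : ∀ s t, T (s + t) = (T s).comp (T t)
  strongly_continuous : ∀ x, Continuous fun t => T t x

/-- The infinitesimal generator of `T` is the operator with graph `A`, including the equality of
the domains: `x` is in the domain of `A` with `A x = y` if and only if
`(T(h) x - x) / h → y` as `h ↓ 0`. -/
def IsGeneratedBy {X : Type*} [NormedAddCommGroup X] [NormedSpace ℝ X]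
    (T : ℝ≥0 → X →L[ℝ] X) (A : X → X → Prop) : Prop :=
  ∀ x y, A x y ↔ Tendsto (fun h : ℝ≥0 => (h : ℝ)⁻¹ • (T h x - x)) (𝓝[>] 0) (𝓝 y)

/-- `S(t) g = P₁ T(t) (0, g)`, where `P₁ (u, v) = u`. -/
def solutionMap {N : ℕ} {Ω : Set (E N)} (T : ℝ≥0 → EnergySpace Ω →L[ℝ] EnergySpace Ω)
    (t : ℝ≥0) (g : L2 Ω) : L2 Ω :=
  toL2 (T t (0, g)).1

/-- The complement in `ℝ²` of the closed unit disc. -/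
def exteriorDisc : Set (E 2) := {x | 1 < ‖x‖}

/-- `f ∈ L²(Ω)` is radially symmetric: it has a representative which is a (measurable) function
of `|x|`. -/
def IsRadial {N : ℕ} {Ω : Set (E N)} (f : L2 Ω) : Prop :=
  ∃ F : ℝ → ℝ, Measurable F ∧ (f : E N → ℝ) =ᵐ[volume.restrict Ω] fun x => F ‖x‖

end DampedWave

end

noncomputable section

namespace DampedWave

/-! ### Semigroups: resolvents as Laplace transforms, the exponential formula, invariant closed
sets. -/

section Semigroup

variable {X : Type*} [NormedAddCommGroup X] [NormedSpace ℝ X]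

/-! For radial `u`, put `w = r^(1/2) exp (t/2) u`. The damped wave equation becomes `(∂ₜ - ∂ᵣ)(∂ₜ +
∂ᵣ) w = (1/4)(1 + r⁻²) w`, with a positive potential on the right. Let `a = (∂ₜ + ∂ᵣ) w`. If `a ≥
0`, then `w ≥ 0`, since `w` is transported outwards from the boundary value `0`. If `w ≥ 0`, then `a
≥ 0` persists, since `a` is transported inwards and needs no boundary condition. So the cone `{w ≥
0, a ≥ 0}` should be invariant, and it contains the data `(0, g)` with `g ≥ 0`.

The argument is carried out on the resolvent equation, where everything is an `L²` identity. A
closed set stable under positive scaling and under the resolvents for large real parameters is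
stable under the semigroup (`IsC0Semigroup.mem_of_resolvent_mem`); this rests on the exponential
formula. Thus it suffices that `positiveCone` is stable under the resolvents
(`resolvent_mem_positiveCone`).

Write `D = ∂ᵣ + 1/(2r)` (`transport`) and `k = l + 1/2`. For the resolvent equation with data `(f,
g)` the counterpart of `a` is `a = D u + k u - f`. The operator `D` is antisymmetric on `H¹₀`, so
testing against `Y` gives `⟨a, (D + k) Y⟩ = ⟨g + D f + f/2, Y⟩ + (1/4)⟨u, Y⟩ + (1/4)⟨u/r, Y/r⟩`
(`inner_shifted_transport_sub`). Choose `Y` with `(D + k) Y = a⁻` (`exists_shiftedTransport_eq`);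
then `Y ≥ 0`, and `‖a⁻‖² ≤ (1/2) ‖u⁻‖ ‖Y‖`. Together with `k ‖Y‖ ≤ ‖a⁻‖` and `k ‖u⁻‖ ≤ ‖a⁻‖` this
forces both negative parts to vanish when `k > 1` (`nonneg_of_weak_solution`).

Radial symmetry is encoded as invariance under rotations, which the resolvent preserves by
uniqueness of weak solutions; averaging over the circle recovers a function of `|x|`. -/

theorem IsC0Semigroup.continuous_toNNReal {T : ℝ≥0 → X →L[ℝ] X} (hT : IsC0Semigroup T) (x : X) :
    Continuous fun s : ℝ => T s.toNNReal x :=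
  (hT.strongly_continuous x).comp continuous_real_toNNReal

theorem IsC0Semigroup.apply_add {T : ℝ≥0 → X →L[ℝ] X} (hT : IsC0Semigroup T) (s t : ℝ≥0) (x : X) :
    T (s + t) x = T s (T t x) := by
  rw [hT.map_add]; rfl

theorem IsC0Semigroup.apply_comm {T : ℝ≥0 → X →L[ℝ] X} (hT : IsC0Semigroup T) (s t : ℝ≥0) (x : X) :
    T s (T t x) = T t (T s x) := by
  rw [← hT.apply_add, add_comm, hT.apply_add]

theorem IsC0Semigroup.apply_nsmul {T : ℝ≥0 → X →L[ℝ] X} (hT : IsC0Semigroup T) (n : ℕ) (t : ℝ≥0)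
    (x : X) : T (n • t) x = (T t)^[n] x := by
  induction n with
  | zero => simp [hT.map_zero]
  | succ n ih => rw [succ_nsmul', hT.apply_add, ih, Function.iterate_succ_apply']

/-- A `C₀`-semigroup is exponentially bounded. -/
theorem IsC0Semigroup.exists_norm_le_exp [CompleteSpace X] {T : ℝ≥0 → X →L[ℝ] X}
    (hT : IsC0Semigroup T) :
    ∃ M w : ℝ, 0 ≤ w ∧ ∀ t : ℝ≥0, ‖T t‖ ≤ M * Real.exp (w * t) := by
  obtain ⟨C, hC⟩ : ∃ C, ∀ t : Set.Icc (0 : ℝ≥0) 1, ‖T t‖ ≤ C := by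
    refine banach_steinhaus fun x => ?_
    obtain ⟨C, hC⟩ := (isCompact_Icc (a := (0 : ℝ≥0)) (b := 1)).exists_bound_of_continuousOn
      (hT.strongly_continuous x).continuousOn
    exact ⟨C, fun t => hC t t.2⟩
  -- Taking the bound at least `1` makes the growth rate `log M` nonnegative and the powers of `M`
  -- monotone.
  set M := max C 1 with hM
  have hM1 : 1 ≤ M := le_max_right _ _
  have hpow : ∀ n : ℕ, ∀ t : ℝ≥0, t ≤ n → ‖T t‖ ≤ M ^ n := by
    intro n
    induction n with
    | zero =>
      intro t ht
      have : t = 0 := by simpa using ht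
      rw [this, hT.map_zero, pow_zero]
      exact ContinuousLinearMap.norm_id_le
    | succ n ih =>
      intro t ht
      have hsplit : t = (t - min t 1) + min t 1 := by
        rw [tsub_add_cancel_of_le (min_le_left _ _)]
      have h1 : t - min t 1 ≤ n := by
        rcases le_total t 1 with h | h
        · simp [h]
        · rw [min_eq_right h]
          exact tsub_le_iff_right.2 (by exact_mod_cast ht)
      rw [hsplit, hT.map_add, pow_succ]
      refine (ContinuousLinearMap.opNorm_comp_le _ _).trans ?_
      exact mul_le_mul (ih _ h1) ((hC ⟨min t 1, ⟨zero_le, min_le_right _ _⟩⟩).trans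
        (le_max_left _ _)) (norm_nonneg _) (by positivity)
  refine ⟨M, Real.log M, Real.log_nonneg hM1, fun t => ?_⟩
  refine (hpow ⌈t⌉₊ t (Nat.le_ceil t)).trans ?_
  have h2 : (⌈t⌉₊ : ℝ) ≤ t + 1 := by exact_mod_cast (Nat.ceil_lt_add_one (zero_le (a := t))).le
  have hM0 : 0 < M := by linarith
  calc M ^ ⌈t⌉₊ = M ^ (⌈t⌉₊ : ℝ) := (Real.rpow_natCast _ _).symm
    _ ≤ M ^ ((t : ℝ) + 1) := Real.rpow_le_rpow_of_exponent_le hM1 h2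
    _ = M * Real.exp (Real.log M * t) := by
      rw [Real.rpow_add_one hM0.ne', Real.rpow_def_of_pos hM0, mul_comm]

/-- Multiplying a `C₀`-semigroup by `exp (-w t)`. -/
def rescale (T : ℝ≥0 → X →L[ℝ] X) (w : ℝ) (t : ℝ≥0) : X →L[ℝ] X := Real.exp (-w * t) • T t

theorem isC0Semigroup_rescale {T : ℝ≥0 → X →L[ℝ] X} (hT : IsC0Semigroup T) (w : ℝ) :
    IsC0Semigroup (rescale T w) where
  map_zero := by simp [rescale, hT.map_zero]
  map_add s t := by
    ext x
    simp only [rescale, hT.map_add, NNReal.coe_add, mul_add, Real.exp_add,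
      smul_apply, ContinuousLinearMap.comp_apply, map_smul, smul_smul]
    rw [mul_comm]
  strongly_continuous x := by
    have := hT.strongly_continuous x
    simp only [rescale, smul_apply]
    exact Continuous.smul (by fun_prop) this

/-- The Laplace transform `∫₀^∞ exp (-l s) T(s) x ds`. -/
def laplace (T : ℝ≥0 → X →L[ℝ] X) (l : ℝ) (x : X) : X :=
  ∫ s in Set.Ioi (0 : ℝ), Real.exp (-l * s) • T s.toNNReal x

variable {T : ℝ≥0 → X →L[ℝ] X} {l c : ℝ} {x : X}

theorem IsC0Semigroup.integrableOn_laplace (hT : IsC0Semigroup T) (hl : 0 < l)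
    (hx : ∀ t, ‖T t x‖ ≤ c) :
    IntegrableOn (fun s : ℝ => Real.exp (-l * s) • T s.toNNReal x) (Set.Ioi 0) := by
  have hcont := hT.continuous_toNNReal x
  refine Integrable.mono' ((exp_neg_integrableOn_Ioi 0 hl).mul_const c)
    (Continuous.smul (by fun_prop) hcont).aestronglyMeasurable ?_
  refine Eventually.of_forall fun s => ?_
  rw [norm_smul, Real.norm_of_nonneg (Real.exp_pos _).le]
  exact mul_le_mul_of_nonneg_left (hx _) (Real.exp_pos _).le

theorem norm_smul_laplace_le (hl : 0 < l)
    (hx : ∀ t, ‖T t x‖ ≤ c) : ‖l • laplace T l x‖ ≤ c := by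
  have h1 : ‖laplace T l x‖ ≤ ∫ s in Set.Ioi (0 : ℝ), Real.exp (-l * s) * c := by
    refine norm_integral_le_of_norm_le ((exp_neg_integrableOn_Ioi 0 hl).mul_const c) ?_
    refine Eventually.of_forall fun s => ?_
    rw [norm_smul, Real.norm_of_nonneg (Real.exp_pos _).le]
    exact mul_le_mul_of_nonneg_left (hx _) (Real.exp_pos _).le
  rw [integral_mul_const, integral_exp_mul_Ioi (by linarith)] at h1
  rw [norm_smul, Real.norm_of_nonneg hl.le]
  calc l * ‖laplace T l x‖ ≤ l * (-Real.exp (-l * 0) / -l * c) := by gcongr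
    _ = c := by simp; field_simp

theorem laplace_add (hT : IsC0Semigroup T) (hl : 0 < l) {M : ℝ} (hM : ∀ t, ‖T t‖ ≤ M) (x y : X) :
    laplace T l (x + y) = laplace T l x + laplace T l y := by
  have hb : ∀ z t, ‖T t z‖ ≤ M * ‖z‖ := fun z t => (T t).le_of_opNorm_le (hM t) z
  unfold laplace
  rw [← integral_add (hT.integrableOn_laplace hl (hb x)) (hT.integrableOn_laplace hl (hb y))]
  simp

theorem laplace_smul (a : ℝ) (x : X) : laplace T l (a • x) = a • laplace T l x := by
  unfold laplace
  rw [← integral_smul]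
  simp only [map_smul, smul_comm a]

/-- The resolvent of the generator of a bounded semigroup, multiplied by `l`. -/
def scaledResolvent (hT : IsC0Semigroup T) {M : ℝ} (hM : ∀ t, ‖T t‖ ≤ M) (hl : 0 < l) : X →L[ℝ] X :=
  LinearMap.mkContinuous
    { toFun := fun x => l • laplace T l x
      map_add' := fun x y => by rw [laplace_add hT hl hM, smul_add]
      map_smul' := fun a x => by rw [laplace_smul, smul_comm]; rfl } M
    fun x => norm_smul_laplace_le hl fun t => (T t).le_of_opNorm_le (hM t) x

theorem scaledResolvent_apply (hT : IsC0Semigroup T) {M : ℝ} (hM : ∀ t, ‖T t‖ ≤ M) (hl : 0 < l)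
    (x : X) : scaledResolvent hT hM hl x = l • laplace T l x := rfl

variable [CompleteSpace X]

theorem IsC0Semigroup.apply_laplace (hT : IsC0Semigroup T) (hl : 0 < l) (hx : ∀ t, ‖T t x‖ ≤ c)
    (t : ℝ≥0) : T t (laplace T l x) = laplace T l (T t x) := by
  unfold laplace
  rw [← (T t).integral_comp_comm (hT.integrableOn_laplace hl hx)]
  simp only [map_smul, hT.apply_comm t]

/-- `l R(l)` does not increase the norm `sup_t ‖T(t) x‖`. -/
theorem IsC0Semigroup.norm_apply_smul_laplace_le (hT : IsC0Semigroup T) (hl : 0 < l)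
    (hx : ∀ t, ‖T t x‖ ≤ c) (t : ℝ≥0) : ‖T t (l • laplace T l x)‖ ≤ c := by
  rw [map_smul, hT.apply_laplace hl hx]
  exact norm_smul_laplace_le hl fun s => by rw [← hT.apply_add]; exact hx _

/-- Substitution `s ↦ s + h` in the Laplace integral. The formula isolates the dependence on `h` in
factors differentiable at `0`, which gives the generator on the range of the resolvent. -/
theorem IsC0Semigroup.apply_laplace_eq (hT : IsC0Semigroup T) (hl : 0 < l)
    (hx : ∀ t, ‖T t x‖ ≤ c) (h : ℝ≥0) : T h (laplace T l x) = Real.exp (l * h) •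
      (laplace T l x - ∫ s in (0 : ℝ)..h, Real.exp (-l * s) • T s.toNNReal x) := by
  have hint := hT.integrableOn_laplace hl hx
  have h1 := intervalIntegral.integral_Ioi_sub_Ioi hint h.2
  change _ = ∫ s in (0 : ℝ)..(h : ℝ), _ at h1
  have h2 : laplace T l x - ∫ s in (0 : ℝ)..h, Real.exp (-l * s) • T s.toNNReal x
      = ∫ s in Set.Ioi (h : ℝ), Real.exp (-l * s) • T s.toNNReal x := by
    rw [← h1]; simp [laplace]
  rw [h2, hT.apply_laplace hl hx, ← integral_smul]
  have h3 : (Set.Ioi (0 : ℝ)) = (fun s => s + (h : ℝ)) ⁻¹' (Set.Ioi (h : ℝ)) := by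
    ext s; simp
  rw [← (measurePreserving_add_right volume (h : ℝ)).setIntegral_preimage_emb
    (measurableEmbedding_addRight (h : ℝ)), ← h3]
  refine setIntegral_congr_fun measurableSet_Ioi fun s hs => ?_
  have hs' : (0 : ℝ) ≤ s := le_of_lt hs
  simp only [smul_smul, ← Real.exp_add]
  rw [Real.toNNReal_add hs' h.coe_nonneg, hT.apply_add, Real.toNNReal_coe]
  congr 2
  ring

/-- `∫₀^∞ exp (-l s) T(s) x ds` is in the domain of the generator. -/
theorem IsC0Semigroup.tendsto_laplace (hT : IsC0Semigroup T) (hl : 0 < l)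
    (hx : ∀ t, ‖T t x‖ ≤ c) :
    Tendsto (fun h : ℝ≥0 => (h : ℝ)⁻¹ • (T h (laplace T l x) - laplace T l x)) (𝓝[>] 0)
      (𝓝 (l • laplace T l x - x)) := by
  have hcont := hT.continuous_toNNReal x
  have hc : Continuous fun s : ℝ => Real.exp (-l * s) • T s.toNNReal x :=
    Continuous.smul (by fun_prop) hcont
  have hd : HasDerivAt (fun h : ℝ => Real.exp (l * h) •
      (laplace T l x - ∫ s in (0 : ℝ)..h, Real.exp (-l * s) • T s.toNNReal x))
      (l • laplace T l x - x) 0 := by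
    have h1 : HasDerivAt (fun h : ℝ => Real.exp (l * h)) l 0 := by
      have := ((hasDerivAt_id (0 : ℝ)).const_mul l).exp
      simpa using this
    have h2 := (hc.integral_hasStrictDerivAt 0 0).hasDerivAt.const_sub (laplace T l x)
    refine (h1.smul h2).congr_deriv ?_
    simp only [intervalIntegral.integral_same]
    rw [Real.toNNReal_zero, hT.map_zero]
    simp
    abel
  have ht := hd.tendsto_slope_zero_right
  have hmap : Tendsto (fun h : ℝ≥0 => (h : ℝ)) (𝓝[>] 0) (𝓝[>] 0) := by
    refine tendsto_nhdsWithin_iff.2 ⟨?_, ?_⟩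
    · exact (NNReal.continuous_coe.tendsto' 0 0 rfl).mono_left nhdsWithin_le_nhds
    · filter_upwards [self_mem_nhdsWithin] with h hh
      exact_mod_cast hh
  refine (ht.comp hmap).congr fun h => ?_
  simp only [Function.comp_apply, zero_add]
  rw [← hT.apply_laplace_eq hl hx]
  simp

/-- `l R(l) x → x` as `l → ∞`. -/
theorem IsC0Semigroup.tendsto_smul_laplace (hT : IsC0Semigroup T) (hx : ∀ t, ‖T t x‖ ≤ c) :
    Tendsto (fun l : ℝ => l • laplace T l x) atTop (𝓝 x) := by
  have hcont := hT.continuous_toNNReal x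
  have key : Tendsto (fun l : ℝ => ∫ s in Set.Ioi (0 : ℝ), Real.exp (-s) • T (l⁻¹ * s).toNNReal x)
      atTop (𝓝 (∫ s in Set.Ioi (0 : ℝ), Real.exp (-s) • x)) := by
    refine tendsto_integral_filter_of_dominated_convergence (fun s => Real.exp (-1 * s) * c) ?_ ?_
      ((exp_neg_integrableOn_Ioi 0 one_pos).mul_const c) ?_
    · refine Eventually.of_forall fun l => Continuous.aestronglyMeasurable ?_
      have : Continuous fun s : ℝ => T (l⁻¹ * s).toNNReal x := hcont.comp (by fun_prop)
      exact Continuous.smul (by fun_prop) this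
    · refine Eventually.of_forall fun l => Eventually.of_forall fun s => ?_
      rw [norm_smul, Real.norm_of_nonneg (Real.exp_pos _).le, neg_one_mul]
      exact mul_le_mul_of_nonneg_left (hx _) (Real.exp_pos _).le
    · refine Eventually.of_forall fun s => Tendsto.const_smul ?_ _
      have h1 : Tendsto (fun l : ℝ => l⁻¹ * s) atTop (𝓝 0) := by
        simpa using tendsto_inv_atTop_zero.mul_const s
      have h2 := (hcont.tendsto 0).comp h1
      rw [Real.toNNReal_zero, hT.map_zero] at h2
      exact h2
  rw [integral_smul_const, integral_exp_neg_Ioi, neg_zero, Real.exp_zero, one_smul] at key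
  refine key.congr' ?_
  filter_upwards [eventually_gt_atTop 0] with l hl
  have := integral_comp_mul_left_Ioi (fun s => Real.exp (-l * s) • T s.toNNReal x) 0 (inv_pos.2 hl)
  rw [inv_inv, mul_zero] at this
  unfold laplace
  rw [← this]
  refine setIntegral_congr_fun measurableSet_Ioi fun s _ => ?_
  congr 2
  field_simp

/-- `T(h) x - R x` is `o(h)`, for the resolvent `R = (1 - h A)⁻¹` and `x` in the domain. -/
theorem IsC0Semigroup.tendsto_sub_scaledResolvent (hT : IsC0Semigroup T) {M : ℝ}
    (hM : ∀ t, ‖T t‖ ≤ M) {y : X}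
    (hy : Tendsto (fun h : ℝ≥0 => (h : ℝ)⁻¹ • (T h x - x)) (𝓝[>] 0) (𝓝 y)) :
    Tendsto (fun h : ℝ≥0 => (h : ℝ)⁻¹ • (T h x - (h : ℝ)⁻¹ • laplace T (h : ℝ)⁻¹ x)) (𝓝[>] 0)
      (𝓝 0) := by
  have hb : ∀ z t, ‖T t z‖ ≤ M * ‖z‖ := fun z t => (T t).le_of_opNorm_le (hM t) z
  -- The resolvent commutes with the generator: both sides are limits of the difference quotients of
  -- `T` at `laplace T l x`.
  have hcomm : ∀ l : ℝ, 0 < l → l • laplace T l x - x = laplace T l y := by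
    intro l hl
    refine tendsto_nhds_unique (hT.tendsto_laplace hl (hb x)) ?_
    have h1 := (((scaledResolvent hT hM hl).continuous.tendsto y).comp hy).const_smul l⁻¹
    simp only [Function.comp_apply, scaledResolvent_apply, smul_smul, inv_mul_cancel₀ hl.ne',
      one_smul] at h1
    refine h1.congr fun h => ?_
    rw [laplace_smul, hT.apply_laplace hl (hb x)]
    congr 1
    rw [sub_eq_add_neg, laplace_add hT hl hM, ← neg_one_smul ℝ x, laplace_smul, neg_one_smul,
      sub_eq_add_neg]
  have hinv : Tendsto (fun h : ℝ≥0 => (h : ℝ)⁻¹) (𝓝[>] 0) atTop := by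
    refine tendsto_inv_nhdsGT_zero.comp (tendsto_nhdsWithin_iff.2 ⟨?_, ?_⟩)
    · exact (NNReal.continuous_coe.tendsto' 0 0 rfl).mono_left nhdsWithin_le_nhds
    · filter_upwards [self_mem_nhdsWithin] with h hh
      exact_mod_cast hh
  have h2 := hy.sub ((hT.tendsto_smul_laplace (hb y)).comp hinv)
  rw [sub_self] at h2
  refine h2.congr' ?_
  filter_upwards [self_mem_nhdsWithin] with h hh
  have hh' : (0 : ℝ) < (h : ℝ)⁻¹ := inv_pos.2 (by exact_mod_cast hh)
  simp only [Function.comp_apply]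
  rw [← hcomm _ hh', ← smul_sub]
  congr 1
  abel

/-- Telescoping of `Tⁿ - Jⁿ` for the commuting operators `T h` and `J = l R(l)`. Keeping `T t` in
front means that errors are measured in the norm `sup_t ‖T(t) x‖`, which neither operator increases,
so the `n` one-step errors add up without powers of `M`. -/
theorem IsC0Semigroup.norm_iterate_sub_le (hT : IsC0Semigroup T) {M : ℝ} (hM : ∀ t, ‖T t‖ ≤ M)
    (hl : 0 < l) (h : ℝ≥0) (hx : ∀ t, ‖T t (T h x - l • laplace T l x)‖ ≤ c) (n : ℕ) :
    ∀ t, ‖T t ((T h)^[n] x - (fun z => l • laplace T l z)^[n] x)‖ ≤ n * c := by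
  have hb : ∀ z t, ‖T t z‖ ≤ M * ‖z‖ := fun z t => (T t).le_of_opNorm_le (hM t) z
  have hcomm : ∀ (n : ℕ) z, (T h)^[n] (scaledResolvent hT hM hl z) =
      scaledResolvent hT hM hl ((T h)^[n] z) := by
    intro n z
    refine (Function.Commute.iterate_left (fun z => ?_) n) z
    rw [scaledResolvent_apply, scaledResolvent_apply, map_smul, hT.apply_laplace hl (hb z)]
  change ∀ t, ‖T t ((T h)^[n] x - (scaledResolvent hT hM hl)^[n] x)‖ ≤ n * c
  induction n with
  | zero => simp
  | succ n ih =>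
    intro t
    have hsplit : (T h)^[n + 1] x - (scaledResolvent hT hM hl)^[n + 1] x =
        (T h)^[n] (T h x - scaledResolvent hT hM hl x) +
        scaledResolvent hT hM hl ((T h)^[n] x - (scaledResolvent hT hM hl)^[n] x) := by
      rw [Function.iterate_succ_apply, Function.iterate_succ_apply', map_sub, ← hcomm]
      simp only [← hT.apply_nsmul n h, map_sub]
      abel
    rw [hsplit, _root_.map_add]
    refine (norm_add_le _ _).trans ?_
    push_cast
    rw [add_one_mul, add_comm]
    refine add_le_add (hT.norm_apply_smul_laplace_le hl ih t) ?_
    rw [← hT.apply_nsmul, ← hT.apply_add]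
    exact hx _

/-- The exponential formula `T(t) x = lim (1 - (t/n) A)⁻ⁿ x` on the domain of the generator. -/
theorem IsC0Semigroup.tendsto_iterate_scaledResolvent (hT : IsC0Semigroup T) {M : ℝ}
    (hM : ∀ t, ‖T t‖ ≤ M) {y : X}
    (hy : Tendsto (fun h : ℝ≥0 => (h : ℝ)⁻¹ • (T h x - x)) (𝓝[>] 0) (𝓝 y)) {t : ℝ≥0} (ht : 0 < t) :
    Tendsto (fun n : ℕ => (fun z => (n / t : ℝ) • laplace T (n / t : ℝ) z)^[n] x) atTop
      (𝓝 (T t x)) := by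
  have hb : ∀ z t, ‖T t z‖ ≤ M * ‖z‖ := fun z t => (T t).le_of_opNorm_le (hM t) z
  have hh : Tendsto (fun n : ℕ => t / n) atTop (𝓝[>] (0 : ℝ≥0)) := by
    refine tendsto_nhdsWithin_iff.2 ⟨?_, ?_⟩
    · exact tendsto_const_div_atTop_nhds_zero_nat t
    · filter_upwards [eventually_gt_atTop 0] with n hn
      have : (0 : ℝ≥0) < n := by exact_mod_cast hn
      exact div_pos ht this
  have h1 := (((hT.tendsto_sub_scaledResolvent hM hy).comp hh).norm.const_mul M).const_mul (t : ℝ)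
  rw [norm_zero, mul_zero, mul_zero] at h1
  rw [tendsto_iff_norm_sub_tendsto_zero]
  refine squeeze_zero' (Eventually.of_forall fun _ => norm_nonneg _) ?_ h1
  filter_upwards [eventually_gt_atTop 0] with n hn
  have hn' : (0 : ℝ) < n := by exact_mod_cast hn
  have ht' : (0 : ℝ) < t := by exact_mod_cast ht
  have hl : (0 : ℝ) < n / t := by positivity
  -- There are `n` steps, each with an error `o(t/n)`, so the total error tends to `0`.
  have h2 := hT.norm_iterate_sub_le hM hl (t / n) (hb (T (t / n) x - _)) n 0
  rw [hT.map_zero, ContinuousLinearMap.id_apply, ← hT.apply_nsmul] at h2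
  have h3 : n • (t / n) = t := by
    rw [nsmul_eq_mul, mul_div_cancel₀]
    exact_mod_cast hn.ne'
  rw [h3, norm_sub_rev] at h2
  refine h2.trans (le_of_eq ?_)
  simp only [Function.comp_apply, NNReal.coe_div, NNReal.coe_natCast, inv_div, norm_smul,
    Real.norm_of_nonneg hl.le]
  field_simp

/-- A closed set that is invariant under positive scaling and under the resolvents of the
generator, for large real parameters, is invariant under the semigroup. -/
theorem IsC0Semigroup.mem_of_resolvent_mem (hT : IsC0Semigroup T) {A : X → X → Prop}
    (hgen : IsGeneratedBy T A) {K : Set X} (hK : IsClosed K)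
    (hsmul : ∀ a : ℝ, 0 < a → ∀ x ∈ K, a • x ∈ K) {l₀ : ℝ}
    (hres : ∀ l : ℝ, l₀ < l → ∀ x ∈ K, ∀ y z, A y z → l • y - z = x → y ∈ K)
    (t : ℝ≥0) (hx : x ∈ K) : T t x ∈ K := by
  rcases eq_or_lt_of_le (zero_le (a := t)) with rfl | ht
  · simpa [hT.map_zero] using hx
  obtain ⟨M, w, -, hMw⟩ := hT.exists_norm_le_exp
  have hS := isC0Semigroup_rescale hT w
  have hM : ∀ t, ‖rescale T w t‖ ≤ M := by
    intro t
    rw [rescale, norm_smul, Real.norm_of_nonneg (Real.exp_pos _).le]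
    calc Real.exp (-w * t) * ‖T t‖ ≤ Real.exp (-w * t) * (M * Real.exp (w * t)) := by
          gcongr; exact hMw t
      _ = M := by rw [mul_left_comm, ← Real.exp_add]; simp
  have hb : ∀ z t, ‖rescale T w t z‖ ≤ M * ‖z‖ := fun z t =>
    (rescale T w t).le_of_opNorm_le (hM t) z
  have hresc : ∀ z, rescale T w t z = Real.exp (-w * t) • T t z := fun z => rfl
  have hlap : ∀ l : ℝ, 0 < l → l₀ < l + w → ∀ x ∈ K, laplace (rescale T w) l x ∈ K := by
    intro l hl hl' x hx
    set y := laplace (rescale T w) l x with hy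
    -- The rescaled semigroup has generator `A - w`, so its resolvent at `l` is that of `A` at `l +
    -- w`.
    refine hres (l + w) hl' x hx y ((l + w) • y - x) ?_ (by abel)
    rw [hgen]
    have h1 := hS.tendsto_laplace hl (hb x)
    rw [← hy] at h1
    have hd : HasDerivAt (fun h : ℝ => Real.exp (w * h)) w 0 := by
      have := ((hasDerivAt_id (0 : ℝ)).const_mul w).exp
      simpa using this
    have hmap : Tendsto (fun h : ℝ≥0 => (h : ℝ)) (𝓝[>] 0) (𝓝[>] 0) := by
      refine tendsto_nhdsWithin_iff.2 ⟨?_, ?_⟩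
      · exact (NNReal.continuous_coe.tendsto' 0 0 rfl).mono_left nhdsWithin_le_nhds
      · filter_upwards [self_mem_nhdsWithin] with h hh
        exact_mod_cast hh
    have h2 := (hd.tendsto_slope_zero_right.comp hmap).smul_const y
    have h3 : Tendsto (fun h : ℝ≥0 => Real.exp (w * h)) (𝓝[>] 0) (𝓝 1) := by
      have : Continuous fun h : ℝ≥0 => Real.exp (w * h) := by fun_prop
      exact (this.tendsto' 0 1 (by simp)).mono_left nhdsWithin_le_nhds
    have h4 := (h3.smul h1).add h2
    have h5 : (1 : ℝ) • (l • y - x) + w • y = (l + w) • y - x := by module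
    rw [h5] at h4
    refine h4.congr fun h => ?_
    have h6 : T h y = Real.exp (w * h) • rescale T w h y := by
      rw [rescale, smul_apply, smul_smul, ← Real.exp_add]
      simp
    rw [h6]
    simp only [Function.comp_apply, zero_add, mul_zero, Real.exp_zero, smul_eq_mul]
    module
  have hJ : ∀ l : ℝ, 0 < l → l₀ < l + w → ∀ x ∈ K, l • laplace (rescale T w) l x ∈ K :=
    fun l hl hl' x hx => hsmul l hl _ (hlap l hl hl' x hx)
  have hdom : ∀ y ∈ K, ∀ z, Tendsto (fun h : ℝ≥0 => (h : ℝ)⁻¹ • (rescale T w h y - y)) (𝓝[>] 0)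
      (𝓝 z) → rescale T w t y ∈ K := by
    intro y hy z hz
    refine hK.mem_of_tendsto (hS.tendsto_iterate_scaledResolvent hM hz ht) ?_
    have h1 : Tendsto (fun n : ℕ => (n / t : ℝ)) atTop atTop :=
      tendsto_natCast_atTop_atTop.atTop_div_const (by exact_mod_cast ht)
    filter_upwards [h1.eventually_gt_atTop 0, h1.eventually_gt_atTop (l₀ - w)] with n hn hn'
    have hmaps : Set.MapsTo (fun z => (n / t : ℝ) • laplace (rescale T w) (n / t : ℝ) z) K K :=
      fun z hz => hJ _ hn (by linarith) z hz
    exact hmaps.iterate n hy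
  -- A general `x ∈ K` is approximated by `l R(l) x`, which lies both in `K` and in the domain of
  -- the generator.
  have hxS : rescale T w t x ∈ K := by
    have h1 := ((rescale T w t).continuous.tendsto x).comp (hS.tendsto_smul_laplace (hb x))
    refine hK.mem_of_tendsto h1 ?_
    filter_upwards [eventually_gt_atTop 0, eventually_gt_atTop (l₀ - w)] with l hl hl'
    have h2 := (hS.tendsto_laplace hl (hb x)).const_smul l
    refine hdom _ (hJ l hl (by linarith) x hx) _ (h2.congr fun h => ?_)
    rw [map_smul, ← smul_sub, smul_comm]
  have := hsmul (Real.exp (w * t)) (Real.exp_pos _) _ hxS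
  rwa [hresc, smul_smul, ← Real.exp_add, neg_mul, add_neg_cancel, Real.exp_zero, one_smul] at this

end Semigroup

/-! ### Derivatives of radial functions and integration by parts in the exterior domain. -/

section Calculus

variable {N : ℕ}

theorem hasFDerivAt_comp_norm {g : ℝ → ℝ} {g' : ℝ} {x : E N} (hx : x ≠ 0)
    (hg : HasDerivAt g g' ‖x‖) :
    HasFDerivAt (fun y : E N => g ‖y‖) ((g' / ‖x‖) • innerSL ℝ x) x := by
  have hn : ‖x‖ ≠ 0 := norm_ne_zero_iff.2 hx
  have h1 : HasFDerivAt (fun y : E N => ‖y‖) ((1 / ‖x‖) • innerSL ℝ x) x := by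
    have h := (hasStrictFDerivAt_norm_sq x).hasFDerivAt.sqrt (pow_ne_zero 2 hn)
    simp only [Real.sqrt_sq (norm_nonneg _)] at h
    refine h.congr_fderiv ?_
    rw [two_smul, ← two_smul ℝ, smul_smul]
    congr 1
    field_simp
  refine (hg.comp_hasFDerivAt x h1).congr_fderiv ?_
  rw [smul_smul]
  congr 1
  ring

theorem partialDeriv_comp_norm {g : ℝ → ℝ} {g' : ℝ} {x : E N} (hx : x ≠ 0)
    (hg : HasDerivAt g g' ‖x‖) (i : Fin N) :
    partialDeriv i (fun y : E N => g ‖y‖) x = g' * (x i / ‖x‖) := by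
  rw [partialDeriv, (hasFDerivAt_comp_norm hx hg).fderiv]
  simp [EuclideanSpace.inner_single_right]
  ring

theorem partialDeriv_coord_mul_comp_norm {g : ℝ → ℝ} {g' : ℝ} {x : E N} (hx : x ≠ 0)
    (hg : HasDerivAt g g' ‖x‖) (i : Fin N) :
    partialDeriv i (fun y : E N => y i * g ‖y‖) x = g ‖x‖ + x i ^ 2 / ‖x‖ * g' := by
  have h1 : HasFDerivAt (fun y : E N => y i) (EuclideanSpace.proj (𝕜 := ℝ) i) x :=
    (EuclideanSpace.proj (𝕜 := ℝ) (ι := Fin N) i).hasFDerivAt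
  rw [partialDeriv, (h1.fun_mul (hasFDerivAt_comp_norm hx hg)).fderiv]
  simp [EuclideanSpace.inner_single_right]
  ring

/-- Integration by parts, for a `C¹` function with compact support. -/
theorem integral_mul_partialDeriv {f F : E N → ℝ} (hF : ContDiff ℝ 1 F)
    (hFc : HasCompactSupport F) (hf : ∀ x ∈ tsupport F, ContDiffAt ℝ 1 f x) (i : Fin N) :
    Integrable (fun x => f x * partialDeriv i F x) ∧
    Integrable (fun x => partialDeriv i f x * F x) ∧
    ∫ x, f x * partialDeriv i F x = - ∫ x, partialDeriv i f x * F x := by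
  have hfc : ContinuousOn f (tsupport F) := fun x hx => (hf x hx).continuousAt.continuousWithinAt
  have hfd : ContinuousOn (partialDeriv i f) (tsupport F) := fun x hx =>
    (((hf x hx).fderiv_right (m := 0) (by simp)).continuousAt.clm_apply
      continuousAt_const).continuousWithinAt
  have hFd : Continuous (partialDeriv i F) :=
    (hF.continuous_fderiv one_ne_zero).clm_apply continuous_const
  have hzero : ∀ x ∉ tsupport F, F x = 0 := fun x hx => image_eq_zero_of_notMem_tsupport hx
  have hzero' : ∀ x ∉ tsupport F, partialDeriv i F x = 0 := fun x hx =>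
    image_eq_zero_of_notMem_tsupport fun h => hx (tsupport_fderiv_apply_subset ℝ _ h)
  have hK : IsCompact (tsupport F) := hFc
  have i1 : Integrable (fun x => f x * partialDeriv i F x) :=
    ((hfc.mul hFd.continuousOn).integrableOn_compact hK).integrable_of_forall_notMem_eq_zero
      fun x hx => by simp [hzero' x hx]
  have i2 : Integrable (fun x => partialDeriv i f x * F x) :=
    ((hfd.mul hF.continuous.continuousOn).integrableOn_compact
      hK).integrable_of_forall_notMem_eq_zero fun x hx => by simp [hzero x hx]
  have i3 : Integrable (fun x => f x * F x) :=
    ((hfc.mul hF.continuous.continuousOn).integrableOn_compact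
      hK).integrable_of_forall_notMem_eq_zero fun x hx => by simp [hzero x hx]
  exact ⟨i1, i2, integral_mul_fderiv_eq_neg_fderiv_mul_of_integrable i2 i1 i3
    (fun x hx => (hf x hx).differentiableAt one_ne_zero)
    fun x _ => hF.differentiable one_ne_zero x⟩

theorem isOpen_exteriorDisc : IsOpen exteriorDisc := isOpen_lt continuous_const continuous_norm

theorem ne_zero_of_mem_exteriorDisc {x : E 2} (hx : x ∈ exteriorDisc) : x ≠ 0 := by
  rintro rfl
  exact absurd hx (by simp [exteriorDisc])

theorem norm_sq_eq_two (x : E 2) : ‖x‖ ^ 2 = x 0 ^ 2 + x 1 ^ 2 := by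
  simp [EuclideanSpace.norm_sq_eq, Fin.sum_univ_two]

/-- The divergence theorem for the vector field `F(x) g(|x|) x` in the exterior of the disc. -/
theorem integral_radial_divergence {g g' : ℝ → ℝ} (hg : ContDiffOn ℝ 1 g (Set.Ioi 0))
    (hg' : ∀ s, 0 < s → HasDerivAt g (g' s) s) {F : E 2 → ℝ} (hF : ContDiff ℝ 1 F)
    (hFc : HasCompactSupport F) (hFs : tsupport F ⊆ exteriorDisc) :
    ∫ x in exteriorDisc, ((∑ i, x i * g ‖x‖ * partialDeriv i F x) +
      (2 * g ‖x‖ + ‖x‖ * g' ‖x‖) * F x) = 0 := by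
  have hθ : ∀ i : Fin 2, ∀ x ∈ tsupport F, ContDiffAt ℝ 1 (fun y : E 2 => y i * g ‖y‖) x := by
    intro i x hx
    have hx0 := ne_zero_of_mem_exteriorDisc (hFs hx)
    have hn : 0 < ‖x‖ := norm_pos_iff.2 hx0
    refine ContDiffAt.mul ?_ ?_
    · exact (EuclideanSpace.proj (𝕜 := ℝ) (ι := Fin 2) i).contDiff.contDiffAt
    · exact ((hg.contDiffAt (Ioi_mem_nhds hn)).comp x (contDiffAt_norm ℝ hx0))
  have hzero : ∀ x ∉ tsupport F, F x = 0 := fun x hx => image_eq_zero_of_notMem_tsupport hx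
  have hzero' : ∀ i, ∀ x ∉ tsupport F, partialDeriv i F x = 0 := fun i x hx =>
    image_eq_zero_of_notMem_tsupport fun h => hx (tsupport_fderiv_apply_subset ℝ _ h)
  have key := fun i => integral_mul_partialDeriv hF hFc (hθ i) i
  rw [setIntegral_eq_integral_of_forall_compl_eq_zero]
  · have hpt : ∀ x, ((∑ i, x i * g ‖x‖ * partialDeriv i F x) +
        (2 * g ‖x‖ + ‖x‖ * g' ‖x‖) * F x) =
        ∑ i : Fin 2, (x i * g ‖x‖ * partialDeriv i F x +
          partialDeriv i (fun y : E 2 => y i * g ‖y‖) x * F x) := by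
      intro x
      by_cases hx : x ∈ tsupport F
      · have hx0 := ne_zero_of_mem_exteriorDisc (hFs hx)
        have hn : 0 < ‖x‖ := norm_pos_iff.2 hx0
        rw [Finset.sum_add_distrib, ← Finset.sum_mul]
        congr 2
        simp only [partialDeriv_coord_mul_comp_norm hx0 (hg' _ hn), Fin.sum_univ_two]
        have := norm_sq_eq_two x
        field_simp
        linear_combination g' ‖x‖ * this
      · simp [hzero x hx, hzero' _ x hx]
    simp_rw [hpt]
    rw [integral_finsetSum]
    · refine Finset.sum_eq_zero fun i _ => ?_
      rw [integral_add (key i).1 (key i).2.1, (key i).2.2]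
      ring
    · exact fun i _ => (key i).1.add (key i).2.1
  · intro x hx
    have hx' : x ∉ tsupport F := fun h => hx (hFs h)
    simp [hzero x hx', hzero' _ x hx']

end Calculus

/-! ### Test functions, weak derivatives and Green's identity on `H¹₀`. -/

section WeakDerivatives

variable {N : ℕ} {Ω : Set (E N)}

theorem inner_L2 (u v : L2 Ω) : inner ℝ u v = ∫ x in Ω, u x * v x := by
  rw [L2.inner_def]
  simp [mul_comm]

theorem IsTestFunction.continuous_partialDeriv {φ : E N → ℝ} (hφ : IsTestFunction Ω φ)
    (i : Fin N) : Continuous (partialDeriv i φ) :=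
  (hφ.smooth.continuous_fderiv (by simp)).clm_apply continuous_const

theorem IsTestFunction.memLp {φ : E N → ℝ} (hφ : IsTestFunction Ω φ) :
    MemLp φ 2 (volume.restrict Ω) :=
  (hφ.smooth.continuous.memLp_of_hasCompactSupport hφ.compact).restrict Ω

theorem IsTestFunction.memLp_partialDeriv {φ : E N → ℝ} (hφ : IsTestFunction Ω φ) (i : Fin N) :
    MemLp (partialDeriv i φ) 2 (volume.restrict Ω) :=
  ((hφ.continuous_partialDeriv i).memLp_of_hasCompactSupport
    (hφ.compact.fderiv_apply ℝ _)).restrict Ω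

/-- The pair `(φ, ∇φ)` given by a test function. -/
def IsTestFunction.pair {φ : E N → ℝ} (hφ : IsTestFunction Ω φ) : L2 Ω × (Fin N → L2 Ω) :=
  (hφ.memLp.toLp φ, fun i => (hφ.memLp_partialDeriv i).toLp _)

theorem IsTestFunction.pair_mem {φ : E N → ℝ} (hφ : IsTestFunction Ω φ) :
    hφ.pair ∈ testPairs Ω :=
  ⟨φ, hφ, hφ.memLp.coeFn_toLp, fun i => (hφ.memLp_partialDeriv i).coeFn_toLp⟩

theorem mem_testPairs_iff {X : L2 Ω × (Fin N → L2 Ω)} :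
    X ∈ testPairs Ω ↔ ∃ φ, ∃ hφ : IsTestFunction Ω φ, X = hφ.pair := by
  constructor
  · rintro ⟨φ, hφ, h1, h2⟩
    refine ⟨φ, hφ, Prod.ext ?_ (funext fun i => ?_)⟩
    · exact Lp.ext (h1.trans hφ.memLp.coeFn_toLp.symm)
    · exact Lp.ext ((h2 i).trans (hφ.memLp_partialDeriv i).coeFn_toLp.symm)
  · rintro ⟨φ, hφ, rfl⟩
    exact hφ.pair_mem

/-- A closed condition that holds for all test functions holds on `H¹₀`. -/
theorem H10_induction {p : L2 Ω × (Fin N → L2 Ω) → Prop} (hp : IsClosed {X | p X})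
    (h : ∀ φ, ∀ hφ : IsTestFunction Ω φ, p hφ.pair) {X : L2 Ω × (Fin N → L2 Ω)}
    (hX : X ∈ H10 Ω) : p X := by
  refine closure_minimal (t := {X | p X}) ?_ hp hX
  intro Y hY
  obtain ⟨φ, hφ, rfl⟩ := mem_testPairs_iff.1 hY
  exact h φ hφ

theorem inner_toLp_right {φ : E N → ℝ} (u : L2 Ω) (hφ : MemLp φ 2 (volume.restrict Ω)) :
    inner ℝ u (hφ.toLp φ) = ∫ x in Ω, u x * φ x := by
  rw [inner_L2]
  refine integral_congr_ae ?_
  filter_upwards [hφ.coeFn_toLp] with x hx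
  rw [hx]

theorem inner_toLp {φ ψ : E N → ℝ} (hφ : MemLp φ 2 (volume.restrict Ω))
    (hψ : MemLp ψ 2 (volume.restrict Ω)) :
    inner ℝ (hφ.toLp φ) (hψ.toLp ψ) = ∫ x in Ω, φ x * ψ x := by
  rw [inner_toLp_right]
  refine integral_congr_ae ?_
  filter_upwards [hφ.coeFn_toLp] with x hx
  rw [hx]

theorem isWeakDeriv_iff {i : Fin N} {u v : L2 Ω} : IsWeakDeriv Ω i u v ↔
    ∀ φ, ∀ hφ : IsTestFunction Ω φ,
      inner ℝ u (hφ.pair.2 i) = - inner ℝ v hφ.pair.1 := by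
  simp only [IsWeakDeriv, IsTestFunction.pair, inner_toLp_right]

theorem isWeakDeriv_of_mem_H10 {X : L2 Ω × (Fin N → L2 Ω)} (hX : X ∈ H10 Ω) (i : Fin N) :
    IsWeakDeriv Ω i X.1 (X.2 i) := by
  rw [isWeakDeriv_iff]
  intro φ hφ
  refine H10_induction (p := fun X => inner ℝ X.1 (hφ.pair.2 i) = - inner ℝ (X.2 i) hφ.pair.1)
    (isClosed_eq (by fun_prop) (by fun_prop)) ?_ hX
  intro ψ hψ
  simp only [IsTestFunction.pair, inner_toLp]
  rw [setIntegral_eq_integral_of_forall_compl_eq_zero,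
    setIntegral_eq_integral_of_forall_compl_eq_zero]
  · exact (integral_mul_partialDeriv (hφ.smooth.of_le (by simp)) hφ.compact
      (fun x _ => (hψ.smooth.of_le (by simp)).contDiffAt) i).2.2
  · intro x hx
    rw [image_eq_zero_of_notMem_tsupport fun h => hx (hφ.supp h), mul_zero]
  · intro x hx
    have : x ∉ tsupport ψ := fun h => hx (hψ.supp h)
    rw [image_eq_zero_of_notMem_tsupport this, zero_mul]

theorem eq_zero_of_inner_test_eq_zero (hΩ : IsOpen Ω) {u : L2 Ω}
    (h : ∀ φ, ∀ hφ : IsTestFunction Ω φ, inner ℝ u hφ.pair.1 = 0) : u = 0 := by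
  refine Lp.ext ?_
  refine EventuallyEq.trans ?_ (Lp.coeFn_zero _ _ _).symm
  rw [EventuallyEq, ae_restrict_iff' hΩ.measurableSet]
  refine hΩ.ae_eq_zero_of_integral_contDiff_smul_eq_zero (μ := volume) ?_ ?_
  · rw [locallyIntegrableOn_iff hΩ.isLocallyClosed]
    intro k hk hkc
    have h1 : MemLp u 2 (volume.restrict k) := (Lp.memLp u).mono_measure
      (Measure.restrict_mono hk le_rfl)
    have : IsFiniteMeasure (volume.restrict k) := ⟨by simpa using hkc.measure_lt_top⟩
    exact h1.integrable (by norm_num)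
  · intro φ h1 h2 h3
    have hφ : IsTestFunction Ω φ := ⟨h1, h2, h3⟩
    have := h φ hφ
    rw [IsTestFunction.pair, inner_toLp_right,
      setIntegral_eq_integral_of_forall_compl_eq_zero] at this
    · simpa [mul_comm] using this
    · intro x hx
      rw [image_eq_zero_of_notMem_tsupport fun h => hx (h3 h), mul_zero]

theorem IsWeakDeriv.unique (hΩ : IsOpen Ω) {i : Fin N} {u v w : L2 Ω} (hv : IsWeakDeriv Ω i u v)
    (hw : IsWeakDeriv Ω i u w) : v = w := by
  rw [isWeakDeriv_iff] at hv hw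
  rw [← sub_eq_zero]
  refine eq_zero_of_inner_test_eq_zero hΩ fun φ hφ => ?_
  rw [inner_sub_left]
  linarith [hv φ hφ, hw φ hφ]

/-- Green's identity on `H¹₀`. -/
theorem IsH2WithLaplacian.sum_inner (hΩ : IsOpen Ω) {X Y : L2 Ω × (Fin N → L2 Ω)} {w : L2 Ω}
    (hX : X ∈ H10 Ω) (hw : IsH2WithLaplacian Ω X.1 w) (hY : Y ∈ H10 Ω) :
    ∑ i, inner ℝ (X.2 i) (Y.2 i) = - inner ℝ w Y.1 := by
  obtain ⟨p, q, hp, hq, rfl⟩ := hw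
  -- The first derivatives witnessing `H²` are the components of the gradient carried by `X`, so the
  -- boundary condition and the Laplacian refer to the same gradient.
  have hpX : ∀ i, p i = X.2 i := fun i => (hp i).unique hΩ (isWeakDeriv_of_mem_H10 hX i)
  refine H10_induction (p := fun Y => ∑ i, inner ℝ (X.2 i) (Y.2 i) = - inner ℝ (∑ i, q i i) Y.1)
    (isClosed_eq (by fun_prop) (by fun_prop)) ?_ hY
  intro φ hφ
  rw [_root_.sum_inner, ← Finset.sum_neg_distrib]
  refine Finset.sum_congr rfl fun i _ => ?_
  rw [← hpX]
  exact isWeakDeriv_iff.1 (hq i i) φ hφ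

end WeakDerivatives

/-! ### Multiplication operators and negative parts in `L²`. -/

section Multiplication

variable {N : ℕ} {Ω : Set (E N)}

/-- Multiplication by a bounded function on `L²(Ω)`. -/
def mulOp (m : E N → ℝ) (hm : MemLp m ⊤ (volume.restrict Ω)) : L2 Ω →L[ℝ] L2 Ω :=
  (ContinuousLinearMap.mul ℝ ℝ).holderL (volume.restrict Ω) ⊤ 2 2 (hm.toLp m)

theorem coeFn_mulOp {m : E N → ℝ} (hm : MemLp m ⊤ (volume.restrict Ω)) (u : L2 Ω) :
    mulOp m hm u =ᵐ[volume.restrict Ω] fun x => m x * u x := by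
  have h := (ContinuousLinearMap.mul ℝ ℝ).coeFn_holder (r := 2) (hm.toLp m) u
  filter_upwards [h, hm.coeFn_toLp] with x hx hx'
  rw [← hx']
  exact hx

theorem inner_mulOp {m : E N → ℝ} (hm : MemLp m ⊤ (volume.restrict Ω)) (u v : L2 Ω) :
    inner ℝ (mulOp m hm u) v = inner ℝ u (mulOp m hm v) := by
  rw [inner_L2, inner_L2]
  refine integral_congr_ae ?_
  filter_upwards [coeFn_mulOp hm u, coeFn_mulOp hm v] with x hx hx'
  rw [hx, hx']
  ring

theorem inner_nonneg_of_nonneg {u v : L2 Ω} (hu : 0 ≤ u) (hv : 0 ≤ v) : 0 ≤ inner ℝ u v := by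
  rw [inner_L2]
  refine integral_nonneg_of_ae ?_
  filter_upwards [(Lp.coeFn_nonneg u).2 hu, (Lp.coeFn_nonneg v).2 hv] with x hx hx'
  exact mul_nonneg hx hx'

theorem negPart_nonneg (u : L2 Ω) : 0 ≤ Lp.negPart u := by
  rw [← Lp.coeFn_nonneg]
  filter_upwards [Lp.coeFn_negPart_eq_max u] with x hx
  rw [hx]
  exact le_max_right _ _

theorem inner_negPart_self (u : L2 Ω) : inner ℝ u (Lp.negPart u) = - ‖Lp.negPart u‖ ^ 2 := by
  rw [← real_inner_self_eq_norm_sq, inner_L2, inner_L2, ← integral_neg]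
  refine integral_congr_ae ?_
  filter_upwards [Lp.coeFn_negPart_eq_max u] with x hx
  rw [hx]
  rcases le_total 0 (u x) with h | h
  · simp [h]
  · simp [h]

theorem neg_inner_negPart_le (u : L2 Ω) {v : L2 Ω} (hv : 0 ≤ v) :
    - inner ℝ (Lp.negPart u) v ≤ inner ℝ u v := by
  have h : 0 ≤ u + Lp.negPart u := by
    rw [← Lp.coeFn_nonneg]
    filter_upwards [Lp.coeFn_negPart_eq_max u, Lp.coeFn_add u (Lp.negPart u)] with x hx hx'
    rw [hx', Pi.add_apply, hx, Pi.zero_apply]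
    linarith [le_max_left (-u x) 0]
  have := inner_nonneg_of_nonneg h hv
  rw [inner_add_left] at this
  linarith

theorem nonneg_of_negPart_eq_zero {u : L2 Ω} (h : Lp.negPart u = 0) : 0 ≤ u := by
  rw [← Lp.coeFn_nonneg]
  have h0 : Lp.negPart u =ᵐ[volume.restrict Ω] 0 := by rw [h]; exact Lp.coeFn_zero _ _ _
  filter_upwards [Lp.coeFn_negPart_eq_max u, h0] with x hx hx'
  rw [hx', Pi.zero_apply] at hx
  have := le_max_left (-u x) 0
  rw [Pi.zero_apply]
  linarith

theorem mulOp_nonneg {m : E N → ℝ} (hm : MemLp m ⊤ (volume.restrict Ω)) (hm0 : ∀ x, 0 ≤ m x)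
    {u : L2 Ω} (hu : 0 ≤ u) : 0 ≤ mulOp m hm u := by
  rw [← Lp.coeFn_nonneg] at hu ⊢
  filter_upwards [hu, coeFn_mulOp hm u] with x hx hx'
  rw [hx']
  exact mul_nonneg (hm0 x) hx

end Multiplication

/-! ### The operator `D = ∂ᵣ + 1/(2r)`: antisymmetry and positivity. -/

section Transport

theorem memLp_top_coord_div_norm (i : Fin 2) :
    MemLp (fun x : E 2 => x i / ‖x‖) ⊤ (volume.restrict exteriorDisc) := by
  refine memLp_top_of_bound (Measurable.aestronglyMeasurable (by fun_prop)) 1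
    (Eventually.of_forall fun x => ?_)
  rw [norm_div, norm_norm]
  exact div_le_one_of_le₀ (PiLp.norm_apply_le x i) (norm_nonneg _)

theorem memLp_top_inv_norm :
    MemLp (fun x : E 2 => ‖x‖⁻¹) ⊤ (volume.restrict exteriorDisc) := by
  refine memLp_top_of_bound (Measurable.aestronglyMeasurable (by fun_prop)) 1 ?_
  filter_upwards [ae_restrict_mem isOpen_exteriorDisc.measurableSet] with x hx
  rw [norm_inv, norm_norm]
  exact inv_le_one_of_one_le₀ (le_of_lt hx)

/-- Multiplication by `xᵢ / |x|`. -/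
def mulDir (i : Fin 2) : L2 exteriorDisc →L[ℝ] L2 exteriorDisc :=
  mulOp _ (memLp_top_coord_div_norm i)

/-- Multiplication by `1 / |x|`. -/
def mulInv : L2 exteriorDisc →L[ℝ] L2 exteriorDisc := mulOp _ memLp_top_inv_norm

/-- The radial derivative `(x / |x|) · ∇u`. -/
def radialDeriv : (L2 exteriorDisc × (Fin 2 → L2 exteriorDisc)) →L[ℝ] L2 exteriorDisc :=
  ∑ i, (mulDir i).comp ((ContinuousLinearMap.proj i).comp (ContinuousLinearMap.snd ℝ _ _))

theorem radialDeriv_apply (X : L2 exteriorDisc × (Fin 2 → L2 exteriorDisc)) :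
    radialDeriv X = ∑ i, mulDir i (X.2 i) := by
  simp [radialDeriv]

/-- The operator `∂ᵣ u + u / (2 r) = r^(-1/2) ∂ᵣ (r^(1/2) u)`. -/
def transport : (L2 exteriorDisc × (Fin 2 → L2 exteriorDisc)) →L[ℝ] L2 exteriorDisc :=
  radialDeriv + (1 / 2 : ℝ) • mulInv.comp (ContinuousLinearMap.fst ℝ _ _)

theorem transport_apply (X : L2 exteriorDisc × (Fin 2 → L2 exteriorDisc)) :
    transport X = radialDeriv X + (1 / 2 : ℝ) • mulInv X.1 := by
  simp [transport]

theorem coeFn_radialDeriv_pair {φ : E 2 → ℝ} (hφ : IsTestFunction exteriorDisc φ) :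
    radialDeriv hφ.pair =ᵐ[volume.restrict exteriorDisc]
      fun x => ∑ i, x i / ‖x‖ * partialDeriv i φ x := by
  rw [radialDeriv_apply, Fin.sum_univ_two]
  filter_upwards [Lp.coeFn_add (mulDir 0 (hφ.pair.2 0)) (mulDir 1 (hφ.pair.2 1)),
    coeFn_mulOp (memLp_top_coord_div_norm 0) (hφ.pair.2 0),
    coeFn_mulOp (memLp_top_coord_div_norm 1) (hφ.pair.2 1),
    (hφ.memLp_partialDeriv 0).coeFn_toLp, (hφ.memLp_partialDeriv 1).coeFn_toLp]
    with x h1 h2 h3 h4 h5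
  rw [h1, Pi.add_apply, Fin.sum_univ_two, ← h4, ← h5]
  exact congrArg₂ (· + ·) h2 h3

theorem coeFn_mulInv_pair {φ : E 2 → ℝ} (hφ : IsTestFunction exteriorDisc φ) :
    mulInv hφ.pair.1 =ᵐ[volume.restrict exteriorDisc] fun x => ‖x‖⁻¹ * φ x := by
  filter_upwards [coeFn_mulOp memLp_top_inv_norm hφ.pair.1, hφ.memLp.coeFn_toLp] with x h1 h2
  rw [← h2]
  exact h1

theorem coeFn_transport_pair {φ : E 2 → ℝ} (hφ : IsTestFunction exteriorDisc φ) :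
    transport hφ.pair =ᵐ[volume.restrict exteriorDisc]
      fun x => (∑ i, x i / ‖x‖ * partialDeriv i φ x) + 1 / 2 * (‖x‖⁻¹ * φ x) := by
  rw [transport_apply]
  filter_upwards [Lp.coeFn_add (radialDeriv hφ.pair) ((1 / 2 : ℝ) • mulInv hφ.pair.1),
    Lp.coeFn_smul (1 / 2 : ℝ) (mulInv hφ.pair.1), coeFn_radialDeriv_pair hφ,
    coeFn_mulInv_pair hφ] with x h1 h2 h3 h4
  rw [h1, Pi.add_apply, h2, Pi.smul_apply, h3, h4, smul_eq_mul]

/-- The divergence identity for `F = G ∘ φ`. Only `C¹` regularity of `G` is required, so that the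
square of the negative part, `G s = (min s 0)²`, is admissible. -/
theorem integral_radial_divergence_comp {g g' : ℝ → ℝ} (hg : ContDiffOn ℝ 1 g (Set.Ioi 0))
    (hg' : ∀ s, 0 < s → HasDerivAt g (g' s) s) {G G' : ℝ → ℝ} (hG : ∀ s, HasDerivAt G (G' s) s)
    (hG' : Continuous G') (hG0 : G 0 = 0) {φ : E 2 → ℝ} (hφ : IsTestFunction exteriorDisc φ) :
    ∫ x in exteriorDisc, ((∑ i, x i * g ‖x‖ * (G' (φ x) * partialDeriv i φ x)) +
      (2 * g ‖x‖ + ‖x‖ * g' ‖x‖) * G (φ x)) = 0 := by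
  have hGc : ContDiff ℝ 1 G := by
    rw [contDiff_one_iff_deriv]
    refine ⟨fun s => (hG s).differentiableAt, ?_⟩
    rwa [show deriv G = G' from funext fun s => (hG s).deriv]
  have hts : tsupport (G ∘ φ) ⊆ tsupport φ := tsupport_comp_subset hG0 φ
  have h := integral_radial_divergence hg hg' (hGc.comp (hφ.smooth.of_le (by simp)))
    (hφ.compact.comp_left hG0) (hts.trans hφ.supp)
  rw [← h]
  refine integral_congr_ae (Eventually.of_forall fun x => ?_)
  have hpd : ∀ i, partialDeriv i (G ∘ φ) x = G' (φ x) * partialDeriv i φ x := by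
    intro i
    rw [partialDeriv, ((hG (φ x)).comp_hasFDerivAt x (hφ.differentiableAt x).hasFDerivAt).fderiv]
    rfl
  simp only [hpd, Function.comp_apply]

theorem hasDerivAt_min_zero_sq (s : ℝ) :
    HasDerivAt (fun s : ℝ => (min s 0) ^ 2) (2 * min s 0) s := by
  rcases lt_trichotomy s 0 with h | rfl | h
  · rw [min_eq_left h.le]
    have h1 : HasDerivAt (fun s : ℝ => s ^ 2) (2 * s) s := by simpa using hasDerivAt_pow 2 s
    refine h1.congr_of_eventuallyEq ?_
    filter_upwards [Iio_mem_nhds h] with y hy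
    rw [min_eq_left (le_of_lt hy)]
  · rw [min_self, mul_zero, hasDerivAt_iff_isLittleO_nhds_zero]
    have h1 : (fun h : ℝ => h ^ 2) =o[𝓝 0] fun h : ℝ => h := by
      simpa using Asymptotics.isLittleO_pow_pow (𝕜 := ℝ) (m := 1) (n := 2) (by norm_num)
    refine (Asymptotics.IsBigO.of_bound 1 (Eventually.of_forall fun y => ?_)).trans_isLittleO h1
    rcases le_total y 0 with hy | hy
    · simp [hy]
    · simp [hy]
  · rw [min_eq_right h.le, mul_zero]
    refine (hasDerivAt_const s (0 : ℝ)).congr_of_eventuallyEq ?_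
    filter_upwards [Ioi_mem_nhds h] with y hy
    rw [min_eq_right (le_of_lt hy)]
    simp

theorem contDiffOn_inv_Ioi : ContDiffOn ℝ 1 (fun s : ℝ => s⁻¹) (Set.Ioi 0) :=
  contDiffOn_id.inv fun _ hs => ne_of_gt hs

/-- Kato's inequality for the first-order operator `transport` (an equality here). -/
theorem inner_transport_negPart {X : L2 exteriorDisc × (Fin 2 → L2 exteriorDisc)}
    (hX : X ∈ H10 exteriorDisc) : inner ℝ (transport X) (Lp.negPart X.1) = 0 := by
  refine H10_induction (p := fun X => inner ℝ (transport X) (Lp.negPart X.1) = 0)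
    (isClosed_eq ?_ continuous_const) ?_ hX
  -- Taking negative parts is continuous on `L²`, so the identity passes to the closure without
  -- differentiating the negative part.
  · exact transport.continuous.inner (Lp.continuous_negPart.comp continuous_fst)
  intro φ hφ
  have h := integral_radial_divergence_comp contDiffOn_inv_Ioi
    (fun s hs => hasDerivAt_inv (ne_of_gt hs)) hasDerivAt_min_zero_sq (by fun_prop) (by simp) hφ
  -- With `g s = s⁻¹` the zeroth-order coefficient `2 g + s g'` is `s⁻¹`, which produces the
  -- `1/(2r)` in `D`. The factor `-1/2` comes from the derivative `2 min s 0` of `G` and from the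
  -- sign of the negative part.
  rw [inner_L2, ← mul_zero (-(1 / 2 : ℝ)), ← h, ← integral_const_mul]
  refine integral_congr_ae ?_
  filter_upwards [coeFn_transport_pair hφ, Lp.coeFn_negPart_eq_max hφ.pair.1,
    hφ.memLp.coeFn_toLp, ae_restrict_mem isOpen_exteriorDisc.measurableSet] with x h1 h2 h3 h4
  have hn : ‖x‖ ≠ 0 := norm_ne_zero_iff.2 (ne_zero_of_mem_exteriorDisc h4)
  have h3' : hφ.pair.1 x = φ x := h3
  rw [h1, h2, h3', Fin.sum_univ_two, Fin.sum_univ_two]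
  rcases le_total (φ x) 0 with hs | hs
  · rw [min_eq_left hs, max_eq_left (by linarith)]
    field_simp
    ring
  · rw [min_eq_right hs, max_eq_right (by linarith)]
    ring

theorem inner_transport_self {X : L2 exteriorDisc × (Fin 2 → L2 exteriorDisc)}
    (hX : X ∈ H10 exteriorDisc) : inner ℝ (transport X) X.1 = 0 := by
  refine H10_induction (p := fun X => inner ℝ (transport X) X.1 = 0)
    (isClosed_eq (by fun_prop) continuous_const) ?_ hX
  intro φ hφ
  have h := integral_radial_divergence_comp contDiffOn_inv_Ioi
    (fun s hs => hasDerivAt_inv (ne_of_gt hs)) (G := fun s => s ^ 2) (G' := fun s => 2 * s)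
    (fun s => by simpa using hasDerivAt_pow 2 s) (by fun_prop) (by simp) hφ
  rw [inner_L2, ← mul_zero (1 / 2 : ℝ), ← h, ← integral_const_mul]
  refine integral_congr_ae ?_
  filter_upwards [coeFn_transport_pair hφ,
    hφ.memLp.coeFn_toLp, ae_restrict_mem isOpen_exteriorDisc.measurableSet] with x h1 h3 h4
  have hn : ‖x‖ ≠ 0 := norm_ne_zero_iff.2 (ne_zero_of_mem_exteriorDisc h4)
  have h3' : hφ.pair.1 x = φ x := h3
  rw [h1, h3', Fin.sum_univ_two, Fin.sum_univ_two]
  field_simp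
  ring

/-- In dimension two the field `x / |x|²` is divergence free, so `∂ᵣ(u²)/r` has integral zero. This
removes the cross terms from `⟨D X, D Y⟩`. -/
theorem inner_radialDeriv_mulInv_self {X : L2 exteriorDisc × (Fin 2 → L2 exteriorDisc)}
    (hX : X ∈ H10 exteriorDisc) : inner ℝ (radialDeriv X) (mulInv X.1) = 0 := by
  refine H10_induction (p := fun X => inner ℝ (radialDeriv X) (mulInv X.1) = 0)
    (isClosed_eq (by fun_prop) continuous_const) ?_ hX
  intro φ hφ
  have h := integral_radial_divergence_comp (g := fun s => s⁻¹ ^ 2)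
    (g' := fun s => -2 * s⁻¹ ^ 3) (contDiffOn_inv_Ioi.pow 2)
    (fun s hs => by
      refine ((hasDerivAt_inv (ne_of_gt hs)).pow 2).congr_deriv ?_
      have := ne_of_gt hs
      norm_num
      field_simp) (G := fun s => s ^ 2) (G' := fun s => 2 * s)
    (fun s => by simpa using hasDerivAt_pow 2 s) (by fun_prop) (by simp) hφ
  rw [inner_L2, ← mul_zero (1 / 2 : ℝ), ← h, ← integral_const_mul]
  refine integral_congr_ae ?_
  filter_upwards [coeFn_radialDeriv_pair hφ, coeFn_mulInv_pair hφ,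
    ae_restrict_mem isOpen_exteriorDisc.measurableSet] with x h1 h2 h4
  have hn : ‖x‖ ≠ 0 := norm_ne_zero_iff.2 (ne_zero_of_mem_exteriorDisc h4)
  rw [h1, h2, Fin.sum_univ_two, Fin.sum_univ_two]
  field_simp
  ring

variable {X Y : L2 exteriorDisc × (Fin 2 → L2 exteriorDisc)}

theorem inner_transport_add_swap (hX : X ∈ H10 exteriorDisc) (hY : Y ∈ H10 exteriorDisc) :
    inner ℝ (transport X) Y.1 + inner ℝ (transport Y) X.1 = 0 := by
  have h := inner_transport_self ((H10 exteriorDisc).add_mem hX hY)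
  simp only [map_add, Prod.fst_add, inner_add_left, inner_add_right] at h
  linarith [inner_transport_self hX, inner_transport_self hY]

theorem inner_radialDeriv_mulInv_add_swap (hX : X ∈ H10 exteriorDisc)
    (hY : Y ∈ H10 exteriorDisc) :
    inner ℝ (radialDeriv X) (mulInv Y.1) + inner ℝ (radialDeriv Y) (mulInv X.1) = 0 := by
  have h := inner_radialDeriv_mulInv_self ((H10 exteriorDisc).add_mem hX hY)
  simp only [map_add, Prod.fst_add, inner_add_left, inner_add_right] at h
  linarith [inner_radialDeriv_mulInv_self hX, inner_radialDeriv_mulInv_self hY]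

/-- This is where the potential `1/(4 r²)` arises: up to it, the radial Dirichlet form is the square
of `D`. -/
theorem inner_transport_transport (hX : X ∈ H10 exteriorDisc) (hY : Y ∈ H10 exteriorDisc) :
    inner ℝ (transport X) (transport Y) =
      inner ℝ (radialDeriv X) (radialDeriv Y) + 1 / 4 * inner ℝ (mulInv X.1) (mulInv Y.1) := by
  simp only [transport_apply, inner_add_left, inner_add_right, inner_smul_left, inner_smul_right,
    conj_trivial]
  have := inner_radialDeriv_mulInv_add_swap hX hY
  rw [real_inner_comm (mulInv X.1) (radialDeriv Y)] at this
  linarith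

theorem inner_shifted_transport_self (k : ℝ) (hX : X ∈ H10 exteriorDisc) :
    inner ℝ (transport X + k • X.1) X.1 = k * ‖X.1‖ ^ 2 := by
  rw [inner_add_left, inner_transport_self hX, inner_smul_left, real_inner_self_eq_norm_sq]
  simp

/-- Since `⟨D X, X⟩ = 0`, pairing with `X` leaves only the term in `k`; then Cauchy–Schwarz. -/
theorem norm_le_norm_shifted_transport (k : ℝ) (hX : X ∈ H10 exteriorDisc) :
    k * ‖X.1‖ ≤ ‖transport X + k • X.1‖ := by
  have h1 := inner_shifted_transport_self k hX
  have h2 := real_inner_le_norm (transport X + k • X.1) X.1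
  rcases eq_or_lt_of_le (norm_nonneg X.1) with h0 | h0
  · rw [← h0, mul_zero]; exact norm_nonneg _
  · refine le_of_mul_le_mul_right ?_ h0
    nlinarith

theorem mul_norm_negPart_sq (k : ℝ) (hX : X ∈ H10 exteriorDisc) :
    k * ‖Lp.negPart X.1‖ ^ 2 = - inner ℝ (transport X + k • X.1) (Lp.negPart X.1) := by
  rw [inner_add_left, inner_transport_negPart hX, inner_smul_left, inner_negPart_self]
  simp

/-- Pairing with the negative part kills `D X`, which leaves `k ‖X⁻‖² ≤ 0`. This expresses that
outward transport from a zero boundary value preserves sign. -/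
theorem nonneg_of_shifted_transport_nonneg {k : ℝ} (hk : 0 < k) (hX : X ∈ H10 exteriorDisc)
    (h : 0 ≤ transport X + k • X.1) : 0 ≤ X.1 := by
  refine nonneg_of_negPart_eq_zero ?_
  have h1 := mul_norm_negPart_sq k hX
  have h2 := inner_nonneg_of_nonneg h (negPart_nonneg X.1)
  have h3 : ‖Lp.negPart X.1‖ ^ 2 ≤ 0 := by
    by_contra hc
    nlinarith
  rw [← norm_eq_zero]
  exact pow_eq_zero_iff two_ne_zero |>.1 (le_antisymm h3 (sq_nonneg _))

end Transport

/-! ### Rotations acting on `L²` and `H¹₀`, and radial symmetry. -/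

section Rotation

theorem measurePreserving_exteriorDisc (R : E 2 ≃ₗᵢ[ℝ] E 2) :
    MeasurePreserving R (volume.restrict exteriorDisc) (volume.restrict exteriorDisc) := by
  have h := R.measurePreserving.restrict_preimage isOpen_exteriorDisc.measurableSet
  have h' : R ⁻¹' exteriorDisc = exteriorDisc := by
    ext x
    simp [exteriorDisc]
  rwa [h'] at h

/-- The action `u ↦ u ∘ R` of a linear isometry on `L²`. -/
def compIso (R : E 2 ≃ₗᵢ[ℝ] E 2) : L2 exteriorDisc →ₗᵢ[ℝ] L2 exteriorDisc :=
  Lp.compMeasurePreservingₗᵢ ℝ R (measurePreserving_exteriorDisc R)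

theorem coeFn_compIso (R : E 2 ≃ₗᵢ[ℝ] E 2) (u : L2 exteriorDisc) :
    compIso R u =ᵐ[volume.restrict exteriorDisc] fun x => u (R x) :=
  Lp.coeFn_compMeasurePreserving u (measurePreserving_exteriorDisc R)

theorem ae_comp_iso (R : E 2 ≃ₗᵢ[ℝ] E 2) {p : E 2 → Prop}
    (h : ∀ᵐ x ∂(volume.restrict exteriorDisc), p x) :
    ∀ᵐ x ∂(volume.restrict exteriorDisc), p (R x) :=
  (measurePreserving_exteriorDisc R).quasiMeasurePreserving.ae h

theorem compIso_compIso_symm (R : E 2 ≃ₗᵢ[ℝ] E 2) (u : L2 exteriorDisc) :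
    compIso R (compIso R.symm u) = u := by
  refine Lp.ext ?_
  filter_upwards [coeFn_compIso R (compIso R.symm u), ae_comp_iso R (coeFn_compIso R.symm u)]
    with x h1 h2
  rw [h1, h2, R.symm_apply_apply]

theorem inner_compIso (R : E 2 ≃ₗᵢ[ℝ] E 2) (u v : L2 exteriorDisc) :
    inner ℝ (compIso R u) v = inner ℝ u (compIso R.symm v) := by
  conv_lhs => rw [← compIso_compIso_symm R v]
  exact (compIso R).inner_map_map _ _

/-- The action of a linear isometry on pairs `(u, ∇u)`. -/
def compIsoPair (R : E 2 ≃ₗᵢ[ℝ] E 2) (X : L2 exteriorDisc × (Fin 2 → L2 exteriorDisc)) :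
    L2 exteriorDisc × (Fin 2 → L2 exteriorDisc) :=
  (compIso R X.1, fun i => ∑ j, (R (EuclideanSpace.single i 1)) j • compIso R (X.2 j))

theorem continuous_compIsoPair (R : E 2 ≃ₗᵢ[ℝ] E 2) : Continuous (compIsoPair R) := by
  have := (compIso R).continuous
  unfold compIsoPair
  fun_prop

theorem apply_eq_sum_single (R : E 2 ≃ₗᵢ[ℝ] E 2) (x : E 2) (j : Fin 2) :
    R x j = ∑ i, x i * (R (EuclideanSpace.single i 1)) j := by
  have hx : x = ∑ i, x i • EuclideanSpace.single i (1 : ℝ) := by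
    ext j
    fin_cases j <;> simp [Fin.sum_univ_two]
  conv_lhs => rw [hx]
  simp [Fin.sum_univ_two]

/-- The inverse of an orthogonal matrix is its transpose. -/
theorem isometry_entry_symm (R : E 2 ≃ₗᵢ[ℝ] E 2) (i j : Fin 2) :
    (R (EuclideanSpace.single i 1)) j = (R.symm (EuclideanSpace.single j 1)) i := by
  have h := R.inner_map_map (EuclideanSpace.single i (1 : ℝ))
    (R.symm (EuclideanSpace.single j (1 : ℝ)))
  rw [R.apply_symm_apply] at h
  simpa [EuclideanSpace.inner_single_left, EuclideanSpace.inner_single_right] using h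

theorem IsTestFunction.comp_iso (R : E 2 ≃ₗᵢ[ℝ] E 2) {φ : E 2 → ℝ}
    (hφ : IsTestFunction exteriorDisc φ) : IsTestFunction exteriorDisc (φ ∘ R) where
  smooth := hφ.smooth.comp R.contDiff
  compact := hφ.compact.comp_homeomorph R.toHomeomorph
  supp := by
    refine (tsupport_comp_subset_preimage φ R.continuous).trans fun x hx => ?_
    have : (1 : ℝ) < ‖R x‖ := hφ.supp hx
    rwa [R.norm_map] at this

/-- For a test function this is the chain rule for `φ ∘ R`; the general case follows by closure. -/
theorem compIsoPair_mem (R : E 2 ≃ₗᵢ[ℝ] E 2) {X : L2 exteriorDisc × (Fin 2 → L2 exteriorDisc)}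
    (hX : X ∈ H10 exteriorDisc) : compIsoPair R X ∈ H10 exteriorDisc := by
  refine H10_induction (p := fun X => compIsoPair R X ∈ H10 exteriorDisc)
    ((Submodule.isClosed_topologicalClosure _).preimage (continuous_compIsoPair R)) ?_ hX
  intro φ hφ
  refine Submodule.le_topologicalClosure _ ⟨φ ∘ R, hφ.comp_iso R, ?_, fun i => ?_⟩
  · filter_upwards [coeFn_compIso R hφ.pair.1, ae_comp_iso R hφ.memLp.coeFn_toLp] with x h1 h2
    exact h1.trans h2
  · simp only [compIsoPair, Fin.sum_univ_two]
    filter_upwards [Lp.coeFn_add ((R (EuclideanSpace.single i 1)) 0 • compIso R (hφ.pair.2 0))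
        ((R (EuclideanSpace.single i 1)) 1 • compIso R (hφ.pair.2 1)),
      Lp.coeFn_smul ((R (EuclideanSpace.single i 1)) 0) (compIso R (hφ.pair.2 0)),
      Lp.coeFn_smul ((R (EuclideanSpace.single i 1)) 1) (compIso R (hφ.pair.2 1)),
      coeFn_compIso R (hφ.pair.2 0), coeFn_compIso R (hφ.pair.2 1),
      ae_comp_iso R (hφ.memLp_partialDeriv 0).coeFn_toLp,
      ae_comp_iso R (hφ.memLp_partialDeriv 1).coeFn_toLp] with x h1 h2 h3 h4 h5 h6 h7
    rw [h1, Pi.add_apply, h2, h3, Pi.smul_apply, Pi.smul_apply, h4, h5]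
    have e0 : hφ.pair.2 0 (R x) = partialDeriv 0 φ (R x) := h6
    have e1 : hφ.pair.2 1 (R x) = partialDeriv 1 φ (R x) := h7
    have hd : HasFDerivAt (φ ∘ R) ((fderiv ℝ φ (R x)).comp
        (R.toContinuousLinearEquiv : E 2 →L[ℝ] E 2)) x :=
      (hφ.differentiableAt (R x)).hasFDerivAt.comp x R.toContinuousLinearEquiv.hasFDerivAt
    rw [e0, e1, partialDeriv, partialDeriv, partialDeriv, hd.fderiv]
    have hsum : R (EuclideanSpace.single i 1) =
        (R (EuclideanSpace.single i 1)) 0 • EuclideanSpace.single (0 : Fin 2) (1 : ℝ) +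
        (R (EuclideanSpace.single i 1)) 1 • EuclideanSpace.single (1 : Fin 2) (1 : ℝ) := by
      ext j
      fin_cases j <;> simp
    change _ = fderiv ℝ φ (R x) (R (EuclideanSpace.single i 1))
    conv_rhs => rw [hsum, map_add, map_smul, map_smul]

theorem sum_inner_compIsoPair (R : E 2 ≃ₗᵢ[ℝ] E 2)
    (X Y : L2 exteriorDisc × (Fin 2 → L2 exteriorDisc)) :
    ∑ i, inner ℝ ((compIsoPair R X).2 i) (Y.2 i) =
      ∑ i, inner ℝ (X.2 i) ((compIsoPair R.symm Y).2 i) := by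
  simp only [compIsoPair, sum_inner, inner_sum, inner_smul_left, inner_smul_right,
    inner_compIso, conj_trivial]
  rw [Finset.sum_comm]
  simp only [isometry_entry_symm R]

theorem radialDeriv_compIsoPair (R : E 2 ≃ₗᵢ[ℝ] E 2)
    (X : L2 exteriorDisc × (Fin 2 → L2 exteriorDisc)) :
    radialDeriv (compIsoPair R X) = compIso R (radialDeriv X) := by
  simp only [radialDeriv_apply, compIsoPair, map_sum, map_smul]
  rw [Finset.sum_comm]
  refine Finset.sum_congr rfl fun j _ => ?_
  rw [Fin.sum_univ_two]
  refine Lp.ext ?_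
  filter_upwards [Lp.coeFn_add
      ((R (EuclideanSpace.single 0 1)) j • mulDir 0 (compIso R (X.2 j)))
      ((R (EuclideanSpace.single 1 1)) j • mulDir 1 (compIso R (X.2 j))),
    Lp.coeFn_smul ((R (EuclideanSpace.single 0 1)) j) (mulDir 0 (compIso R (X.2 j))),
    Lp.coeFn_smul ((R (EuclideanSpace.single 1 1)) j) (mulDir 1 (compIso R (X.2 j))),
    coeFn_mulOp (memLp_top_coord_div_norm 0) (compIso R (X.2 j)),
    coeFn_mulOp (memLp_top_coord_div_norm 1) (compIso R (X.2 j)),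
    coeFn_compIso R (X.2 j), coeFn_compIso R (mulDir j (X.2 j)),
    ae_comp_iso R (coeFn_mulOp (memLp_top_coord_div_norm j) (X.2 j))] with x h1 h2 h3 h4 h5 h6 h7 h8
  have e0 : mulDir 0 (compIso R (X.2 j)) x = x 0 / ‖x‖ * compIso R (X.2 j) x := h4
  have e1 : mulDir 1 (compIso R (X.2 j)) x = x 1 / ‖x‖ * compIso R (X.2 j) x := h5
  have e2 : mulDir j (X.2 j) (R x) = R x j / ‖R x‖ * X.2 j (R x) := h8
  rw [h1, Pi.add_apply, h2, h3, Pi.smul_apply, Pi.smul_apply, e0, e1, h6, h7, e2, R.norm_map,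
    apply_eq_sum_single R x j, Fin.sum_univ_two, smul_eq_mul, smul_eq_mul]
  ring

theorem mulInv_compIso (R : E 2 ≃ₗᵢ[ℝ] E 2) (u : L2 exteriorDisc) :
    mulInv (compIso R u) = compIso R (mulInv u) := by
  refine Lp.ext ?_
  filter_upwards [coeFn_mulOp memLp_top_inv_norm (compIso R u), coeFn_compIso R u,
    coeFn_compIso R (mulInv u), ae_comp_iso R (coeFn_mulOp memLp_top_inv_norm u)] with x h1 h2 h3 h4
  have e1 : mulInv (compIso R u) x = ‖x‖⁻¹ * compIso R u x := h1
  have e2 : mulInv u (R x) = ‖R x‖⁻¹ * u (R x) := h4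
  rw [e1, h2, h3, e2, R.norm_map]

theorem transport_compIsoPair (R : E 2 ≃ₗᵢ[ℝ] E 2)
    (X : L2 exteriorDisc × (Fin 2 → L2 exteriorDisc)) :
    transport (compIsoPair R X) = compIso R (transport X) := by
  rw [transport_apply, radialDeriv_compIsoPair, transport_apply, map_add, map_smul,
    ← mulInv_compIso]
  rfl

/-- The weak solution `X ∈ H¹₀` of `m u - Δu = G` inherits the symmetries of `G`. -/
theorem compIsoPair_eq_of_weak_solution (R : E 2 ≃ₗᵢ[ℝ] E 2)
    {X : L2 exteriorDisc × (Fin 2 → L2 exteriorDisc)} (hX : X ∈ H10 exteriorDisc)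
    {m : ℝ} (hm : 0 < m) {G : L2 exteriorDisc} (hG : compIso R G = G)
    (hw : ∀ Y ∈ H10 exteriorDisc,
      ∑ i, inner ℝ (X.2 i) (Y.2 i) + m * inner ℝ X.1 Y.1 = inner ℝ G Y.1) :
    compIsoPair R X = X := by
  have hZ := (H10 exteriorDisc).sub_mem (compIsoPair_mem R hX) hX
  set Z := compIsoPair R X - X with hZdef
  -- Testing with `Z ∘ R⁻¹` gives the weak equation for `X ∘ R` tested with `Z`. Subtracting the
  -- equation for `X` leaves `‖∇Z‖² + m ‖Z‖² = 0`.
  have h1 := hw _ (compIsoPair_mem R.symm hZ)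
  rw [← sum_inner_compIsoPair] at h1
  change _ + m * inner ℝ X.1 (compIso R.symm Z.1) = inner ℝ G (compIso R.symm Z.1) at h1
  rw [← inner_compIso, ← inner_compIso, hG] at h1
  have h2 := hw Z hZ
  have h3 : ∑ i, ‖Z.2 i‖ ^ 2 + m * ‖Z.1‖ ^ 2 = 0 := by
    have e1 : ∀ i, ‖Z.2 i‖ ^ 2 =
        inner ℝ ((compIsoPair R X).2 i) (Z.2 i) - inner ℝ (X.2 i) (Z.2 i) := fun i => by
      rw [← real_inner_self_eq_norm_sq, ← inner_sub_left]; rfl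
    have e2 : ‖Z.1‖ ^ 2 = inner ℝ (compIso R X.1) Z.1 - inner ℝ X.1 Z.1 := by
      rw [← real_inner_self_eq_norm_sq, ← inner_sub_left]; rfl
    simp only [e1, e2, Finset.sum_sub_distrib]
    linarith
  rw [← sub_eq_zero, ← hZdef]
  have h4 : 0 ≤ ∑ i, ‖Z.2 i‖ ^ 2 := Finset.sum_nonneg fun i _ => sq_nonneg _
  have h5 : ‖Z.1‖ ^ 2 = 0 := by nlinarith [sq_nonneg ‖Z.1‖]
  have h6 : ∑ i, ‖Z.2 i‖ ^ 2 = 0 := by rw [h5] at h3; linarith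
  rw [Finset.sum_eq_zero_iff_of_nonneg fun i _ => sq_nonneg _] at h6
  refine Prod.ext ?_ (funext fun i => ?_)
  · simpa using h5
  · simpa using h6 i (Finset.mem_univ i)

theorem IsRadial.compIso_eq {u : L2 exteriorDisc} (hu : IsRadial u) (R : E 2 ≃ₗᵢ[ℝ] E 2) :
    compIso R u = u := by
  obtain ⟨F, -, hF⟩ := hu
  refine Lp.ext ?_
  filter_upwards [coeFn_compIso R u, hF, ae_comp_iso R hF] with x h1 h2 h3
  rw [h1, h2, h3, R.norm_map]

/-- The rotation of the plane by the angle `θ`. -/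
def rot (θ : ℝ) : E 2 ≃ₗᵢ[ℝ] E 2 :=
  Complex.orthonormalBasisOneI.repr.symm.trans
    ((rotation (Circle.exp θ)).trans Complex.orthonormalBasisOneI.repr)

theorem rot_apply (θ : ℝ) (x : E 2) : rot θ x = Complex.orthonormalBasisOneI.repr
    (Complex.exp (θ * Complex.I) * Complex.orthonormalBasisOneI.repr.symm x) := by
  simp [rot, rotation_apply]

theorem continuous_rot : Continuous fun p : ℝ × E 2 => rot p.1 p.2 := by
  simp only [rot_apply]
  have h1 := Complex.orthonormalBasisOneI.repr.continuous
  have h2 := Complex.orthonormalBasisOneI.repr.symm.continuous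
  fun_prop

theorem rot_add (θ θ' : ℝ) (x : E 2) : rot (θ + θ') x = rot θ (rot θ' x) := by
  simp only [rot_apply, LinearIsometryEquiv.symm_apply_apply, Complex.ofReal_add, add_mul,
    Complex.exp_add, mul_assoc]

theorem rot_two_pi (x : E 2) : rot (2 * Real.pi) x = x := by
  rw [rot_apply]
  push_cast
  rw [Complex.exp_two_pi_mul_I, one_mul, LinearIsometryEquiv.apply_symm_apply]

theorem exists_rot_eq (x : E 2) : ∃ θ, x = rot θ (‖x‖ • EuclideanSpace.single 0 1) := by
  refine ⟨(Complex.orthonormalBasisOneI.repr.symm x).arg, ?_⟩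
  have h1 : Complex.orthonormalBasisOneI.repr.symm (‖x‖ • EuclideanSpace.single 0 1) =
      (‖Complex.orthonormalBasisOneI.repr.symm x‖ : ℂ) := by
    rw [LinearIsometryEquiv.norm_map, Complex.orthonormalBasisOneI_repr_symm_apply]
    simp
  rw [rot_apply, h1, mul_comm, Complex.norm_mul_exp_arg_mul_I,
    LinearIsometryEquiv.apply_symm_apply]

/-- A function in `L²` that is invariant under all rotations is a function of `|x|`. -/
theorem isRadial_of_rot_invariant {u : L2 exteriorDisc} (h : ∀ θ, compIso (rot θ) u = u) :
    IsRadial u := by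
  let f : E 2 → ℝ := fun x => u x
  have hfm : StronglyMeasurable f := Lp.stronglyMeasurable u
  have hfm2 : StronglyMeasurable fun p : E 2 × ℝ => f (rot p.2 p.1) :=
    hfm.comp_measurable (continuous_rot.comp continuous_swap).measurable
  let A : E 2 → ℝ := fun x => ∫ θ in (0 : ℝ)..(2 * Real.pi), f (rot θ x)
  have hA : Measurable A := by
    have : StronglyMeasurable fun x => ∫ θ in Set.Ioc 0 (2 * Real.pi), f (rot θ x) :=
      StronglyMeasurable.integral_prod_right (f := fun x θ => f (rot θ x)) hfm2
    simpa only [A, intervalIntegral.integral_of_le Real.two_pi_pos.le] using this.measurable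
  -- The angular average is invariant at every point, not just almost everywhere, so it is an honest
  -- function of `|x|`.
  have hinv : ∀ θ' x, A (rot θ' x) = A x := by
    intro θ' x
    have hper : Function.Periodic (fun θ => f (rot θ x)) (2 * Real.pi) := fun θ => by
      simp only [rot_add, rot_two_pi]
    have h1 := hper.intervalIntegral_add_eq θ' 0
    rw [zero_add] at h1
    simp only [A, ← rot_add]
    rw [← h1, intervalIntegral.integral_comp_add_right (fun θ => f (rot θ x)), zero_add, add_comm]
  refine ⟨fun r => (2 * Real.pi)⁻¹ * A (r • EuclideanSpace.single 0 1),
    (hA.comp (by fun_prop)).const_mul _, ?_⟩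
  have hae : ∀ᵐ x ∂(volume.restrict exteriorDisc), ∀ᵐ θ ∂(volume : Measure ℝ),
      f (rot θ x) = f x := by
    -- Invariance holds for each `θ` at almost every `x`; Fubini turns this into: for almost every
    -- `x`, at almost every `θ`.
    rw [Measure.ae_ae_comm]
    · refine Eventually.of_forall fun θ => ?_
      have h1 := coeFn_compIso (rot θ) u
      rw [h θ] at h1
      filter_upwards [h1] with x hx
      exact hx.symm
    · exact measurableSet_eq_fun hfm2.measurable (hfm.measurable.comp measurable_fst)
  filter_upwards [hae] with x hx
  obtain ⟨θ, hθ⟩ := exists_rot_eq x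
  have h2 : A x = A (‖x‖ • EuclideanSpace.single 0 1) := by
    conv_lhs => rw [hθ]
    exact hinv _ _
  have h3 : A x = 2 * Real.pi * f x := by
    have : A x = ∫ θ in (0 : ℝ)..(2 * Real.pi), f x := by
      refine intervalIntegral.integral_congr_ae ?_
      filter_upwards [hx] with θ hθ _ using hθ
    rw [this, intervalIntegral.integral_const]
    simp
  rw [← h2, h3]
  have := Real.pi_ne_zero
  field_simp
  rfl

end Rotation

/-! ### Radial test functions, the kernel function of `D + k`, and cutoffs. -/

section RadialTest

theorem isTestFunction_comp_norm {h : ℝ → ℝ} (hh : ContDiff ℝ ∞ h) (hc : HasCompactSupport h)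
    (hs : tsupport h ⊆ Set.Ioi 1) : IsTestFunction exteriorDisc fun x => h ‖x‖ where
  smooth := by
    rw [contDiff_iff_contDiffAt]
    intro x
    by_cases hx : x = 0
    · subst hx
      have h0 : (0 : ℝ) ∉ tsupport h := fun h0 => absurd (hs h0) (by simp)
      have h1 : ∀ᶠ y : E 2 in 𝓝 0, ‖y‖ ∉ tsupport h := by
        have : Tendsto (fun y : E 2 => ‖y‖) (𝓝 0) (𝓝 0) := tendsto_norm_zero
        exact this.eventually ((isClosed_tsupport h).isOpen_compl.mem_nhds h0)
      refine (contDiffAt_const (c := (0 : ℝ))).congr_of_eventuallyEq ?_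
      filter_upwards [h1] with y hy
      exact image_eq_zero_of_notMem_tsupport hy
    · exact hh.contDiffAt.comp x (contDiffAt_norm ℝ hx)
  compact := by
    obtain ⟨C, hC⟩ := hc.isBounded.exists_norm_le
    refine HasCompactSupport.intro (isCompact_closedBall (0 : E 2) C) fun x hx => ?_
    refine image_eq_zero_of_notMem_tsupport fun hx' => hx ?_
    have := hC _ hx'
    rw [norm_norm] at this
    simpa using this
  supp := fun _ hx => hs (tsupport_comp_subset_preimage h continuous_norm hx)

/-- The elements of `H¹₀` whose gradient is radial. -/
def radialGradient : Submodule ℝ (L2 exteriorDisc × (Fin 2 → L2 exteriorDisc)) :=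
  H10 exteriorDisc ⊓ ⨅ i : Fin 2, LinearMap.ker
    (((ContinuousLinearMap.proj i).comp (ContinuousLinearMap.snd ℝ _ _) -
      (mulDir i).comp radialDeriv : (L2 exteriorDisc × (Fin 2 → L2 exteriorDisc)) →L[ℝ]
        L2 exteriorDisc) : (L2 exteriorDisc × (Fin 2 → L2 exteriorDisc)) →ₗ[ℝ] L2 exteriorDisc)

theorem mem_radialGradient {Y : L2 exteriorDisc × (Fin 2 → L2 exteriorDisc)} :
    Y ∈ radialGradient ↔ Y ∈ H10 exteriorDisc ∧ ∀ i, Y.2 i = mulDir i (radialDeriv Y) := by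
  simp [radialGradient, Submodule.mem_iInf, sub_eq_zero]

theorem isClosed_radialGradient :
    IsClosed (radialGradient : Set (L2 exteriorDisc × (Fin 2 → L2 exteriorDisc))) := by
  have : (radialGradient : Set (L2 exteriorDisc × (Fin 2 → L2 exteriorDisc))) =
      (H10 exteriorDisc : Set _) ∩ ⋂ i, {Y | Y.2 i = mulDir i (radialDeriv Y)} := by
    ext Y
    simp only [SetLike.mem_coe, Set.mem_inter_iff, Set.mem_iInter, Set.mem_ofPred_eq,
      mem_radialGradient]
  rw [this]
  exact (Submodule.isClosed_topologicalClosure _).inter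
    (isClosed_iInter fun i => isClosed_eq (by fun_prop) (by fun_prop))

theorem coeFn_radialDeriv_comp_norm {h h' : ℝ → ℝ} (hh : ∀ s, 0 < s → HasDerivAt h (h' s) s)
    (hφ : IsTestFunction exteriorDisc fun x => h ‖x‖) :
    radialDeriv hφ.pair =ᵐ[volume.restrict exteriorDisc] fun x => h' ‖x‖ := by
  filter_upwards [coeFn_radialDeriv_pair hφ,
    ae_restrict_mem isOpen_exteriorDisc.measurableSet] with x h1 h2
  have hx0 := ne_zero_of_mem_exteriorDisc h2
  have hn := norm_pos_iff.2 hx0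
  rw [h1, Fin.sum_univ_two, partialDeriv_comp_norm hx0 (hh _ hn),
    partialDeriv_comp_norm hx0 (hh _ hn)]
  have := norm_sq_eq_two x
  field_simp
  linear_combination (-h' ‖x‖) * this

theorem pair_mem_radialGradient {h h' : ℝ → ℝ} (hh : ∀ s, 0 < s → HasDerivAt h (h' s) s)
    (hφ : IsTestFunction exteriorDisc fun x => h ‖x‖) : hφ.pair ∈ radialGradient := by
  refine mem_radialGradient.2 ⟨Submodule.le_topologicalClosure _ hφ.pair_mem, fun i => ?_⟩
  refine Lp.ext ?_
  filter_upwards [coeFn_radialDeriv_comp_norm hh hφ,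
    coeFn_mulOp (memLp_top_coord_div_norm i) (radialDeriv hφ.pair),
    (hφ.memLp_partialDeriv i).coeFn_toLp,
    ae_restrict_mem isOpen_exteriorDisc.measurableSet] with x h1 h2 h3 h4
  have hx0 := ne_zero_of_mem_exteriorDisc h4
  have hn := norm_pos_iff.2 hx0
  rw [h1] at h2
  refine h3.trans (Eq.trans ?_ h2.symm)
  rw [partialDeriv_comp_norm hx0 (hh _ hn)]
  ring

/-- The operator `∂ᵣ u + u / (2 r) + k u`. -/
def shiftedTransport (k : ℝ) :
    (L2 exteriorDisc × (Fin 2 → L2 exteriorDisc)) →L[ℝ] L2 exteriorDisc :=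
  transport + k • ContinuousLinearMap.fst ℝ _ _

theorem shiftedTransport_apply (k : ℝ) (X : L2 exteriorDisc × (Fin 2 → L2 exteriorDisc)) :
    shiftedTransport k X = transport X + k • X.1 := by
  simp [shiftedTransport]

/-- The function `r^(-1/2) exp (-k r)`, annihilated by `∂ᵣ + 1 / (2 r) + k`. -/
def decay (k s : ℝ) : ℝ := Real.exp (-k * s) / √s

theorem decay_pos (k : ℝ) {s : ℝ} (hs : 0 < s) : 0 < decay k s :=
  div_pos (Real.exp_pos _) (Real.sqrt_pos.2 hs)

theorem measurable_decay (k : ℝ) : Measurable (decay k) := by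
  unfold decay
  fun_prop

theorem contDiffAt_decay (k : ℝ) {s : ℝ} (hs : 0 < s) : ContDiffAt ℝ ∞ (decay k) s := by
  unfold decay
  refine ContDiffAt.div (by fun_prop) (Real.contDiffAt_sqrt hs.ne') (Real.sqrt_pos.2 hs).ne'

theorem hasDerivAt_decay (k : ℝ) {s : ℝ} (hs : 0 < s) :
    HasDerivAt (decay k) (-(k + 1 / (2 * s)) * decay k s) s := by
  have h1 : HasDerivAt (fun s : ℝ => Real.exp (-k * s)) (Real.exp (-k * s) * -k) s := by
    simpa using ((hasDerivAt_id s).const_mul (-k)).exp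
  refine (h1.div (Real.hasDerivAt_sqrt hs.ne') (Real.sqrt_pos.2 hs).ne').congr_deriv ?_
  have h2 := (Real.sqrt_pos.2 hs).ne'
  have h3 := Real.sq_sqrt hs.le
  unfold decay
  field_simp
  rw [h3]
  ring

/-- Square integrability of `decay k` allows it to be paired with `L²` functions, and makes the
cutoff errors at infinity vanish in the density argument. -/
theorem memLp_decay {k : ℝ} (hk : 0 < k) :
    MemLp (fun x : E 2 => decay k ‖x‖) 2 (volume.restrict exteriorDisc) := by
  have hm : Measurable fun x : E 2 => decay k ‖x‖ := (measurable_decay k).comp measurable_norm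
  rw [memLp_two_iff_integrable_sq hm.aestronglyMeasurable]
  have h1 : Integrable (fun x : E 2 => (1 + ‖x‖) ^ (-(3 : ℝ))) (volume.restrict exteriorDisc) :=
    (integrable_one_add_norm (by simp; norm_num)).restrict
  -- The constant comes from `y³ / 3! ≤ exp y` at `y = 2 k (1 + |x|)`; the exponent `3` exceeds the
  -- dimension, so the majorant is integrable.
  refine (h1.const_mul (Real.exp (2 * k) * 6 / (2 * k) ^ 3)).mono'
    (hm.pow_const 2).aestronglyMeasurable ?_
  filter_upwards [ae_restrict_mem isOpen_exteriorDisc.measurableSet] with x hx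
  have hx1 : 1 < ‖x‖ := hx
  have hx0 : 0 < ‖x‖ := by linarith
  rw [Real.norm_of_nonneg (sq_nonneg _), decay, div_pow, Real.sq_sqrt hx0.le, ← Real.exp_nat_mul]
  have h2 := Real.pow_div_factorial_le_exp (2 * k * (1 + ‖x‖)) (by positivity) 3
  have h3 : Real.exp (2 * k * (1 + ‖x‖)) = Real.exp (2 * k) * Real.exp (2 * k * ‖x‖) := by
    rw [← Real.exp_add]; ring_nf
  have h4 : Real.exp (((2 : ℕ) : ℝ) * (-k * ‖x‖)) = (Real.exp (2 * k * ‖x‖))⁻¹ := by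
    rw [← Real.exp_neg]; congr 1; push_cast; ring
  have h5 : (1 + ‖x‖) ^ (-(3 : ℝ)) = ((1 + ‖x‖) ^ 3)⁻¹ := by
    rw [Real.rpow_neg (by linarith)]
    norm_cast
  rw [h4, h5]
  rw [h3] at h2
  norm_num [Nat.factorial] at h2
  refine (div_le_self (by positivity) hx1.le).trans ?_
  rw [inv_le_iff_one_le_mul₀ (Real.exp_pos _)]
  have h6 : (2 * k * (1 + ‖x‖)) ^ 3 = (2 * k) ^ 3 * (1 + ‖x‖) ^ 3 := by ring
  rw [h6] at h2
  have h7 : (0 : ℝ) < (2 * k) ^ 3 * (1 + ‖x‖) ^ 3 := by positivity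
  have h8 : Real.exp (2 * k) * 6 / (2 * k) ^ 3 * ((1 + ‖x‖) ^ 3)⁻¹ * Real.exp (2 * k * ‖x‖) =
      6 * (Real.exp (2 * k) * Real.exp (2 * k * ‖x‖)) / ((2 * k) ^ 3 * (1 + ‖x‖) ^ 3) := by
    field_simp
  rw [h8, le_div_iff₀ h7]
  linarith

/-- On radial test functions of the form `decay k · κ` the shifted transport operator is
`κ ↦ decay k · κ'`. -/
theorem exists_radialGradient_decay_mul (k : ℝ) {f : ℝ → ℝ} (hf : ContDiff ℝ ∞ f)
    (hc : HasCompactSupport f) (hs : tsupport f ⊆ Set.Ioi 1) :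
    ∃ Y ∈ radialGradient, shiftedTransport k Y =ᵐ[volume.restrict exteriorDisc]
      fun x => decay k ‖x‖ * deriv f ‖x‖ := by
  have hts : tsupport (fun s => decay k s * f s) ⊆ tsupport f := tsupport_mul_subset_right
  have hsm : ContDiff ℝ ∞ (fun s => decay k s * f s) := by
    rw [contDiff_iff_contDiffAt]
    intro s
    by_cases h0 : 0 < s
    · exact (contDiffAt_decay k h0).mul hf.contDiffAt
    · have hs0 : s ∉ tsupport f := fun h => h0 (lt_trans one_pos (hs h))
      refine (contDiffAt_const (c := (0 : ℝ))).congr_of_eventuallyEq ?_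
      filter_upwards [(isClosed_tsupport f).isOpen_compl.mem_nhds hs0] with y hy
      rw [image_eq_zero_of_notMem_tsupport hy, mul_zero]
  have hφ := isTestFunction_comp_norm hsm hc.mul_left (hts.trans hs)
  have hder : ∀ s, 0 < s → HasDerivAt (fun s => decay k s * f s)
      (-(k + 1 / (2 * s)) * decay k s * f s + decay k s * deriv f s) s := fun s h0 =>
    (hasDerivAt_decay k h0).mul (hf.differentiable (by simp) s).hasDerivAt
  refine ⟨hφ.pair, pair_mem_radialGradient hder hφ, ?_⟩
  rw [shiftedTransport_apply, transport_apply]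
  filter_upwards [coeFn_radialDeriv_comp_norm hder hφ, coeFn_mulInv_pair hφ,
    hφ.memLp.coeFn_toLp, ae_restrict_mem isOpen_exteriorDisc.measurableSet,
    Lp.coeFn_add (radialDeriv hφ.pair + (1 / 2 : ℝ) • mulInv hφ.pair.1) (k • hφ.pair.1),
    Lp.coeFn_add (radialDeriv hφ.pair) ((1 / 2 : ℝ) • mulInv hφ.pair.1),
    Lp.coeFn_smul (1 / 2 : ℝ) (mulInv hφ.pair.1), Lp.coeFn_smul k hφ.pair.1]
    with x h1 h2 h3 h4 h5 h6 h7 h8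
  have hn := norm_pos_iff.2 (ne_zero_of_mem_exteriorDisc h4)
  have h3' : hφ.pair.1 x = decay k ‖x‖ * f ‖x‖ := h3
  rw [h5, Pi.add_apply, h6, Pi.add_apply, h7, h8, Pi.smul_apply, Pi.smul_apply, h1, h2, h3',
    smul_eq_mul, smul_eq_mul]
  field_simp
  ring

/-- A smooth cutoff, equal to `1` on `(-∞, n]` and to `0` on `[n + 1, ∞)`. -/
def cutoff (n : ℕ) (s : ℝ) : ℝ := Real.smoothTransition (n + 1 - s)

theorem contDiff_cutoff (n : ℕ) : ContDiff ℝ ∞ (cutoff n) :=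
  Real.smoothTransition.contDiff.comp (by fun_prop)

theorem cutoff_of_le {n : ℕ} {s : ℝ} (h : s ≤ n) : cutoff n s = 1 :=
  Real.smoothTransition.one_of_one_le (by linarith)

theorem cutoff_of_ge {n : ℕ} {s : ℝ} (h : (n : ℝ) + 1 ≤ s) : cutoff n s = 0 :=
  Real.smoothTransition.zero_of_nonpos (by linarith)

theorem exists_abs_deriv_cutoff_le : ∃ C, ∀ n s, |deriv (cutoff n) s| ≤ C := by
  have hc : ContDiff ℝ ∞ Real.smoothTransition := Real.smoothTransition.contDiff
  have hd : HasCompactSupport (deriv Real.smoothTransition) := by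
    refine HasCompactSupport.intro (isCompact_Icc (a := (0 : ℝ)) (b := 1)) fun s hs => ?_
    rw [Set.mem_Icc, not_and_or, not_le, not_le] at hs
    rcases hs with hs | hs
    · have : Real.smoothTransition =ᶠ[𝓝 s] fun _ => 0 := by
        filter_upwards [Iio_mem_nhds hs] with y hy
        exact Real.smoothTransition.zero_of_nonpos (le_of_lt hy)
      rw [this.deriv_eq, deriv_const]
    · have : Real.smoothTransition =ᶠ[𝓝 s] fun _ => 1 := by
        filter_upwards [Ioi_mem_nhds hs] with y hy
        exact Real.smoothTransition.one_of_one_le (le_of_lt hy)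
      rw [this.deriv_eq, deriv_const]
  obtain ⟨C, hC⟩ := hd.exists_bound_of_continuous (hc.continuous_deriv (by simp))
  refine ⟨C, fun n s => ?_⟩
  have h1 : deriv (cutoff n) s = - deriv Real.smoothTransition (n + 1 - s) := by
    unfold cutoff
    rw [deriv_comp_const_sub]
  rw [h1, abs_neg]
  exact hC _

theorem deriv_cutoff_of_lt {n : ℕ} {s : ℝ} (h : s < n) : deriv (cutoff n) s = 0 := by
  have : cutoff n =ᶠ[𝓝 s] fun _ => 1 := by
    filter_upwards [Iio_mem_nhds h] with y hy
    exact cutoff_of_le (le_of_lt hy)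
  rw [this.deriv_eq, deriv_const]

end RadialTest

/-! ### Solving `(D + k) Y = ζ` for rotation-invariant `ζ`. -/

section Surjectivity

/-- A test function `ρ` is the derivative of its primitive `P`, which may remain a nonzero constant
at infinity and so need not be a test function. Cutting `P` off at radius `n` costs the term `P ·
cutoff'`, which is bounded and supported where `|x| ≥ n`; integrability of `z · decay k` makes it
disappear in the limit. -/
theorem integral_decay_mul_eq_zero {k : ℝ} (hk : 0 < k) {z : L2 exteriorDisc}
    (hz : ∀ f : ℝ → ℝ, ContDiff ℝ ∞ f → HasCompactSupport f → tsupport f ⊆ Set.Ioi 1 →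
      ∫ x in exteriorDisc, z x * (decay k ‖x‖ * deriv f ‖x‖) = 0)
    {ρ : ℝ → ℝ} (hρ : ContDiff ℝ ∞ ρ) (hc : HasCompactSupport ρ) (hs : tsupport ρ ⊆ Set.Ioi 1) :
    ∫ x in exteriorDisc, z x * (decay k ‖x‖ * ρ ‖x‖) = 0 := by
  obtain ⟨a, ha1, ha⟩ : ∃ a, 1 < a ∧ ∀ s ∈ tsupport ρ, a ≤ s := by
    rcases (tsupport ρ).eq_empty_or_nonempty with h | h
    · exact ⟨2, one_lt_two, by simp [h]⟩
    · obtain ⟨a, ha⟩ := IsCompact.exists_isLeast hc h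
      exact ⟨a, hs ha.1, ha.2⟩
  have hint : Integrable ρ := hρ.continuous.integrable_of_hasCompactSupport hc
  let P : ℝ → ℝ := fun s => ∫ t in (0 : ℝ)..s, ρ t
  have hPd : ∀ s, HasDerivAt P (ρ s) s := fun s =>
    (hρ.continuous.integral_hasStrictDerivAt 0 s).hasDerivAt
  have hPsm : ContDiff ℝ ∞ P := by
    rw [contDiff_infty_iff_deriv]
    refine ⟨fun s => (hPd s).differentiableAt, ?_⟩
    rwa [show deriv P = ρ from funext fun s => (hPd s).deriv]
  have hP0 : ∀ s, s < a → P s = 0 := by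
    intro s hsa
    refine (intervalIntegral.integral_congr (g := fun _ => (0 : ℝ)) fun t ht => ?_).trans (by simp)
    refine image_eq_zero_of_notMem_tsupport fun h => ?_
    have h1 := ha t h
    have h2 := ht.2
    have h3 : max 0 s < a := max_lt (by linarith) hsa
    linarith
  obtain ⟨B, hB⟩ : ∃ B, ∀ s, |P s| ≤ B := by
    refine ⟨∫ t, ‖ρ t‖, fun s => ?_⟩
    exact intervalIntegral.norm_integral_le_integral_norm_uIoc.trans
      (setIntegral_le_integral hint.norm (Eventually.of_forall fun _ => norm_nonneg _))
  obtain ⟨B', hB'⟩ := hc.exists_bound_of_continuous hρ.continuous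
  obtain ⟨C, hC⟩ := exists_abs_deriv_cutoff_le
  have hcut : ∀ n s, |cutoff n s| ≤ 1 := fun n s => by
    rw [cutoff, abs_of_nonneg (Real.smoothTransition.nonneg _)]
    exact Real.smoothTransition.le_one _
  have hder : ∀ n s, deriv (fun s => P s * cutoff n s) s =
      ρ s * cutoff n s + P s * deriv (cutoff n) s := fun n s =>
    ((hPd s).mul ((contDiff_cutoff n).differentiable (by simp) s).hasDerivAt).deriv
  have hzero : ∀ n : ℕ, ∫ x in exteriorDisc, z x * (decay k ‖x‖ *
      deriv (fun s => P s * cutoff n s) ‖x‖) = 0 := by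
    intro n
    have hsupp : Function.support (fun s => P s * cutoff n s) ⊆ Set.Icc a (n + 1) := by
      intro s hs'
      by_contra hcon
      rw [Set.mem_Icc, not_and_or, not_le, not_le] at hcon
      refine hs' ?_
      rcases hcon with h | h
      · simp [hP0 s h]
      · simp [cutoff_of_ge h.le]
    have hts : tsupport (fun s => P s * cutoff n s) ⊆ Set.Icc a (n + 1) :=
      closure_minimal hsupp isClosed_Icc
    refine hz _ (hPsm.mul (contDiff_cutoff n)) (HasCompactSupport.of_support_subset_isCompact
      isCompact_Icc hsupp) fun s hs' => ?_
    exact lt_of_lt_of_le ha1 (hts hs').1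
  have hzp : Integrable (fun x => z x * decay k ‖x‖) (volume.restrict exteriorDisc) :=
    (Lp.memLp z).integrable_mul (memLp_decay hk)
  have hlim : Tendsto (fun n : ℕ => ∫ x in exteriorDisc, z x * (decay k ‖x‖ *
      deriv (fun s => P s * cutoff n s) ‖x‖)) atTop
      (𝓝 (∫ x in exteriorDisc, z x * (decay k ‖x‖ * ρ ‖x‖))) := by
    refine tendsto_integral_of_dominated_convergence
      (fun x => ‖z x * decay k ‖x‖‖ * (B' + B * C)) ?_ (hzp.norm.mul_const _) ?_ ?_
    · intro n
      simp only [← mul_assoc]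
      refine hzp.aestronglyMeasurable.mul (Continuous.aestronglyMeasurable ?_)
      exact ((hPsm.mul (contDiff_cutoff n)).continuous_deriv (by simp)).comp continuous_norm
    · intro n
      refine Eventually.of_forall fun x => ?_
      rw [← mul_assoc, norm_mul]
      refine mul_le_mul_of_nonneg_left ?_ (norm_nonneg _)
      rw [hder]
      refine (norm_add_le _ _).trans (add_le_add ?_ ?_)
      · rw [norm_mul]
        calc ‖ρ ‖x‖‖ * ‖cutoff n ‖x‖‖ ≤ ‖ρ ‖x‖‖ * 1 := by
              gcongr; exact hcut n _
          _ ≤ B' := by rw [mul_one]; exact hB' _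
      · rw [norm_mul]
        exact mul_le_mul (hB _) (hC n _) (norm_nonneg _) ((abs_nonneg _).trans (hB 0))
    · refine Eventually.of_forall fun x => ?_
      refine tendsto_const_nhds.congr' ?_
      filter_upwards [(tendsto_natCast_atTop_atTop (R := ℝ)).eventually_gt_atTop ‖x‖] with n hn
      rw [hder, cutoff_of_le hn.le, deriv_cutoff_of_lt hn]
      ring
  refine tendsto_nhds_unique hlim ?_
  simp only [hzero]
  exact tendsto_const_nhds

/-- Pushing the measure forward under `x ↦ |x|` reduces the claim to the fundamental lemma of the
calculus of variations on `(1, ∞)`; the factor `decay k` is positive there and can be divided out.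
-/
theorem eq_zero_of_integral_decay_mul_eq_zero {k : ℝ} (hk : 0 < k) {z : L2 exteriorDisc}
    (hzr : IsRadial z)
    (hz : ∀ ρ : ℝ → ℝ, ContDiff ℝ ∞ ρ → HasCompactSupport ρ → tsupport ρ ⊆ Set.Ioi 1 →
      ∫ x in exteriorDisc, z x * (decay k ‖x‖ * ρ ‖x‖) = 0) : z = 0 := by
  obtain ⟨F, hFm, hF⟩ := hzr
  set ν : Measure ℝ := (volume.restrict exteriorDisc).map (fun x : E 2 => ‖x‖) with hν
  have hm : Measurable fun s => F s * decay k s := hFm.mul (measurable_decay k)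
  have hzp : Integrable (fun x => z x * decay k ‖x‖) (volume.restrict exteriorDisc) :=
    (Lp.memLp z).integrable_mul (memLp_decay hk)
  have hint : Integrable (fun s => F s * decay k s) ν := by
    rw [hν, integrable_map_measure hm.aestronglyMeasurable measurable_norm.aemeasurable]
    refine hzp.congr ?_
    filter_upwards [hF] with x hx
    rw [hx, Function.comp_apply]
  have h1 : ∀ᵐ s ∂ν, s ∈ Set.Ioi (1 : ℝ) → F s * decay k s = 0 := by
    refine isOpen_Ioi.ae_eq_zero_of_integral_contDiff_smul_eq_zero
      (hint.locallyIntegrable.locallyIntegrableOn _) fun ρ h1 h2 h3 => ?_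
    have h4 : Measurable fun s => ρ s • (F s * decay k s) := h1.continuous.measurable.smul hm
    have h5 : Measurable fun x : E 2 => ‖x‖ := measurable_norm
    rw [hν, integral_map h5.aemeasurable h4.aestronglyMeasurable, ← hz ρ h1 h2 h3]
    refine integral_congr_ae ?_
    filter_upwards [hF] with x hx
    rw [hx, smul_eq_mul]
    ring
  have h2 := ae_of_ae_map measurable_norm.aemeasurable h1
  refine Lp.ext ?_
  filter_upwards [h2, hF, ae_restrict_mem isOpen_exteriorDisc.measurableSet,
    Lp.coeFn_zero ℝ 2 (volume.restrict exteriorDisc)] with x h3 h4 h5 h6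
  have hx1 : 1 < ‖x‖ := h5
  rw [h6, h4, Pi.zero_apply]
  exact (mul_eq_zero.1 (h3 hx1)).resolve_right (decay_pos k (by linarith)).ne'

/-- The rotation-invariant elements of `L²`. -/
def rotInvariant : Submodule ℝ (L2 exteriorDisc) :=
  ⨅ θ : ℝ, LinearMap.ker ((compIso (rot θ)).toLinearMap - LinearMap.id)

theorem mem_rotInvariant {u : L2 exteriorDisc} :
    u ∈ rotInvariant ↔ ∀ θ, compIso (rot θ) u = u := by
  simp [rotInvariant, Submodule.mem_iInf, sub_eq_zero]

theorem isClosed_rotInvariant : IsClosed (rotInvariant : Set (L2 exteriorDisc)) := by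
  have : (rotInvariant : Set (L2 exteriorDisc)) = ⋂ θ : ℝ, {u | compIso (rot θ) u = u} := by
    ext u
    simp only [SetLike.mem_coe, Set.mem_iInter, Set.mem_ofPred_eq, mem_rotInvariant]
  rw [this]
  exact isClosed_iInter fun θ => isClosed_eq (compIso (rot θ)).continuous continuous_id

/-- On the closed subspace of radial gradients the operator is bounded below in the full norm: `‖u‖`
is controlled by antisymmetry of `D`, `∂ᵣ u` by the equation, and each `∂ᵢ u` equals `(xᵢ/|x|) ∂ᵣ
u`. -/
theorem isClosed_range_shiftedTransport {k : ℝ} (hk : 0 < k) :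
    IsClosed (radialGradient.map (shiftedTransport k :
      (L2 exteriorDisc × (Fin 2 → L2 exteriorDisc)) →ₗ[ℝ] L2 exteriorDisc) :
        Set (L2 exteriorDisc)) := by
  have : CompleteSpace radialGradient := isClosed_radialGradient.completeSpace_coe
  let f : radialGradient →L[ℝ] L2 exteriorDisc :=
    (shiftedTransport k).comp radialGradient.subtypeL
  have hrange : (radialGradient.map (shiftedTransport k :
      (L2 exteriorDisc × (Fin 2 → L2 exteriorDisc)) →ₗ[ℝ] L2 exteriorDisc) :
        Set (L2 exteriorDisc)) = Set.range f := by
    ext u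
    simp [f]
  rw [hrange]
  obtain ⟨C, hC⟩ : ∃ C : ℝ≥0, ∀ Y : radialGradient, ‖Y‖ ≤ C * ‖f Y‖ := by
    set c : ℝ := 1 + (1 / 2 * ‖mulInv‖ + k) * k⁻¹ with hc
    have hc0 : 0 ≤ c := by positivity
    refine ⟨⟨k⁻¹ + ∑ i, ‖mulDir i‖ * c, by positivity⟩, fun Y => ?_⟩
    obtain ⟨Z, hZ⟩ := Y
    set Y : radialGradient := ⟨Z, hZ⟩
    obtain ⟨hY, hYi⟩ := mem_radialGradient.1 hZ
    have hfY : f Y = transport Z + k • Z.1 := shiftedTransport_apply k Z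
    have h1 : ‖Z.1‖ ≤ k⁻¹ * ‖f Y‖ := by
      have := norm_le_norm_shifted_transport k hY
      rw [← hfY] at this
      rwa [le_inv_mul_iff₀ hk]
    have h2 : ‖radialDeriv Z‖ ≤ c * ‖f Y‖ := by
      have e : radialDeriv Z = f Y - ((1 / 2 : ℝ) • mulInv Z.1 + k • Z.1) := by
        rw [hfY, transport_apply]; abel
      rw [e]
      calc ‖f Y - ((1 / 2 : ℝ) • mulInv Z.1 + k • Z.1)‖
          ≤ ‖f Y‖ + (1 / 2 * (‖mulInv‖ * ‖Z.1‖) + k * ‖Z.1‖) := by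
            refine (norm_sub_le _ _).trans (add_le_add le_rfl
              ((norm_add_le _ _).trans (add_le_add ?_ ?_)))
            · rw [norm_smul]
              norm_num
              exact mulInv.le_opNorm _
            · rw [norm_smul, Real.norm_of_nonneg hk.le]
        _ = ‖f Y‖ + (1 / 2 * ‖mulInv‖ + k) * ‖Z.1‖ := by ring
        _ ≤ ‖f Y‖ + (1 / 2 * ‖mulInv‖ + k) * (k⁻¹ * ‖f Y‖) := by gcongr
        _ = c * ‖f Y‖ := by rw [hc]; ring
    have h3 : ∀ i, ‖Z.2 i‖ ≤ (∑ i, ‖mulDir i‖ * c) * ‖f Y‖ := by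
      intro i
      rw [hYi i]
      calc ‖mulDir i (radialDeriv Z)‖ ≤ ‖mulDir i‖ * ‖radialDeriv Z‖ := (mulDir i).le_opNorm _
        _ ≤ ‖mulDir i‖ * (c * ‖f Y‖) := by gcongr
        _ = (‖mulDir i‖ * c) * ‖f Y‖ := by ring
        _ ≤ (∑ i, ‖mulDir i‖ * c) * ‖f Y‖ := by
          gcongr
          exact Finset.single_le_sum (f := fun i => ‖mulDir i‖ * c)
            (fun j _ => by positivity) (Finset.mem_univ i)
    change ‖Z‖ ≤ (k⁻¹ + ∑ i, ‖mulDir i‖ * c) * ‖f Y‖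
    rw [Prod.norm_def, add_mul]
    have h4 : 0 ≤ k⁻¹ * ‖f Y‖ := by positivity
    have h5 : 0 ≤ (∑ i, ‖mulDir i‖ * c) * ‖f Y‖ := by positivity
    refine max_le (by linarith) ((pi_norm_le_iff_of_nonneg (by linarith)).2 fun i => ?_)
    linarith [h3 i]
  exact (AddMonoidHomClass.antilipschitz_of_bound f hC).isClosed_range f.uniformContinuous

/-- Every radial function in `L²` is of the form `∂ᵣ u + u / (2 r) + k u`, with `u ∈ H¹₀` having a
radial gradient. -/
theorem exists_shiftedTransport_eq {k : ℝ} (hk : 0 < k) {ζ : L2 exteriorDisc}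
    (hζ : ζ ∈ rotInvariant) : ∃ Y ∈ radialGradient, transport Y + k • Y.1 = ζ := by
  -- The range is intersected with the invariant functions because `radialGradient` constrains only
  -- the gradient. The residual `z` is then a difference of invariant functions, hence radial, and
  -- its orthogonality to `V` can be tested on radial functions.
  set V : Submodule ℝ (L2 exteriorDisc) := radialGradient.map (shiftedTransport k :
      (L2 exteriorDisc × (Fin 2 → L2 exteriorDisc)) →ₗ[ℝ] L2 exteriorDisc) ⊓ rotInvariant with hV
  have hVc : IsClosed (V : Set (L2 exteriorDisc)) :=
    (isClosed_range_shiftedTransport hk).inter isClosed_rotInvariant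
  have : CompleteSpace V := hVc.completeSpace_coe
  obtain ⟨v, hv, z, hz, hvz⟩ := V.exists_add_mem_mem_orthogonal ζ
  have hzr : IsRadial z := by
    refine isRadial_of_rot_invariant (mem_rotInvariant.1 ?_)
    have : z = ζ - v := by rw [hvz]; abel
    rw [this]
    exact rotInvariant.sub_mem hζ hv.2
  have hz0 : z = 0 := by
    refine eq_zero_of_integral_decay_mul_eq_zero hk hzr fun ρ h1 h2 h3 =>
      integral_decay_mul_eq_zero hk (fun f hf hfc hfs => ?_) h1 h2 h3
    obtain ⟨Y, hY, hYe⟩ := exists_radialGradient_decay_mul k hf hfc hfs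
    have hmem : shiftedTransport k Y ∈ V := by
      refine ⟨⟨Y, hY, rfl⟩, mem_rotInvariant.2 fun θ => ?_⟩
      refine IsRadial.compIso_eq ⟨fun s => decay k s * deriv f s, ?_, hYe⟩ _
      exact (measurable_decay k).mul (measurable_deriv f)
    have h4 := (Submodule.mem_orthogonal' V z).1 hz _ hmem
    rw [inner_L2] at h4
    rw [← h4]
    refine integral_congr_ae ?_
    filter_upwards [hYe] with x hx
    rw [hx]
  rw [hz0, add_zero] at hvz
  obtain ⟨Y, hY, hYv⟩ := hv.1
  exact ⟨Y, hY, by rw [← shiftedTransport_apply, hvz]; exact hYv⟩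

end Surjectivity

/-! ### The cone and its invariance under the resolvents. -/

section Cone

theorem mulInv_le_self {u : L2 exteriorDisc} (hu : 0 ≤ u) : mulInv u ≤ u := by
  rw [← Lp.coeFn_nonneg] at hu
  rw [← Lp.coeFn_le]
  filter_upwards [hu, coeFn_mulOp memLp_top_inv_norm u,
    ae_restrict_mem isOpen_exteriorDisc.measurableSet] with x h1 h2 h3
  have e : mulInv u x = ‖x‖⁻¹ * u x := h2
  rw [e]
  exact mul_le_of_le_one_left h1 (inv_le_one_of_one_le₀ (le_of_lt h3))

theorem mulInv_nonneg {u : L2 exteriorDisc} (hu : 0 ≤ u) : 0 ≤ mulInv u :=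
  mulOp_nonneg memLp_top_inv_norm (fun _ => inv_nonneg.2 (norm_nonneg _)) hu

theorem compIso_negPart (R : E 2 ≃ₗᵢ[ℝ] E 2) (u : L2 exteriorDisc) :
    compIso R (Lp.negPart u) = Lp.negPart (compIso R u) := by
  refine Lp.ext ?_
  filter_upwards [coeFn_compIso R (Lp.negPart u), coeFn_compIso R u,
    Lp.coeFn_negPart_eq_max (compIso R u), ae_comp_iso R (Lp.coeFn_negPart_eq_max u)]
    with x h1 h2 h3 h4
  rw [h1, h3, h4, h2]

/-- The factorised form of the resolvent equation `(l² + l) u - Δu = g + (l + 1) f`. -/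
theorem inner_shifted_transport_sub {U F Y : L2 exteriorDisc × (Fin 2 → L2 exteriorDisc)}
    (hU : U ∈ H10 exteriorDisc) (hF : F ∈ H10 exteriorDisc) (hY : Y ∈ radialGradient)
    {g : L2 exteriorDisc} {l : ℝ}
    (hw : ∑ i, inner ℝ (U.2 i) (Y.2 i) + (l ^ 2 + l) * inner ℝ U.1 Y.1 =
      inner ℝ (g + (l + 1) • F.1) Y.1) :
    inner ℝ (transport U + (l + 1 / 2) • U.1 - F.1) (transport Y + (l + 1 / 2) • Y.1) =
      inner ℝ (g + transport F + (1 / 2 : ℝ) • F.1) Y.1 + 1 / 4 * inner ℝ U.1 Y.1 +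
        1 / 4 * inner ℝ (mulInv U.1) (mulInv Y.1) := by
  obtain ⟨hY1, hYi⟩ := mem_radialGradient.1 hY
  -- A radial gradient for `Y` alone suffices: it extracts the radial component of the gradient of
  -- `U`.
  have h1 : ∑ i, inner ℝ (U.2 i) (Y.2 i) = inner ℝ (radialDeriv U) (radialDeriv Y) := by
    rw [radialDeriv_apply U, sum_inner]
    refine Finset.sum_congr rfl fun i _ => ?_
    rw [hYi i]
    exact (inner_mulOp _ _ _).symm
  rw [h1] at hw
  have h2 := inner_transport_transport hU hY1
  have h3 := inner_transport_add_swap hU hY1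
  have h4 := inner_transport_add_swap hF hY1
  rw [real_inner_comm U.1 (transport Y)] at h3
  rw [real_inner_comm F.1 (transport Y)] at h4
  simp only [inner_add_left, inner_add_right, inner_sub_left, inner_smul_left, inner_smul_right,
    conj_trivial] at hw h2 h3 h4 ⊢
  linear_combination h2 + hw + (l + 1 / 2) * h3 - h4

/-- The positivity statement behind the invariance of the cone under the resolvent. -/
theorem nonneg_of_weak_solution {U F : L2 exteriorDisc × (Fin 2 → L2 exteriorDisc)}
    (hU : U ∈ H10 exteriorDisc) (hF : F ∈ H10 exteriorDisc) {g : L2 exteriorDisc} {l : ℝ}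
    (hl : 1 / 2 < l) (hw : ∀ Y ∈ H10 exteriorDisc, ∑ i, inner ℝ (U.2 i) (Y.2 i) +
      (l ^ 2 + l) * inner ℝ U.1 Y.1 = inner ℝ (g + (l + 1) • F.1) Y.1)
    (hinv : transport U + (l + 1 / 2) • U.1 - F.1 ∈ rotInvariant)
    (hF0 : 0 ≤ F.1) (hb : 0 ≤ g + transport F + (1 / 2 : ℝ) • F.1) :
    0 ≤ U.1 ∧ 0 ≤ transport U + (l + 1 / 2) • U.1 - F.1 := by
  have hk : 0 < l + 1 / 2 := by linarith
  set a := transport U + (l + 1 / 2) • U.1 - F.1 with ha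
  -- This test function turns the left side of the factorised equation into `⟨a, a⁻⟩ = -‖a⁻‖²`.
  obtain ⟨Y, hY, hYa⟩ := exists_shiftedTransport_eq hk (ζ := Lp.negPart a)
    (mem_rotInvariant.2 fun θ => by rw [compIso_negPart, mem_rotInvariant.1 hinv])
  have hY1 := (mem_radialGradient.1 hY).1
  have hY0 : 0 ≤ Y.1 :=
    nonneg_of_shifted_transport_nonneg hk hY1 (by rw [hYa]; exact negPart_nonneg a)
  have hYn := norm_le_norm_shifted_transport (l + 1 / 2) hY1
  rw [hYa] at hYn
  have hid := inner_shifted_transport_sub hU hF hY (hw Y hY1)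
  rw [hYa, ← ha, inner_negPart_self] at hid
  have h1 := inner_nonneg_of_nonneg hb hY0
  have h2 := neg_inner_negPart_le U.1 hY0
  have h3 : - inner ℝ (Lp.negPart U.1) Y.1 ≤ inner ℝ (mulInv U.1) (mulInv Y.1) := by
    have e1 : inner ℝ (mulInv U.1) (mulInv Y.1) = inner ℝ U.1 (mulInv (mulInv Y.1)) :=
      inner_mulOp _ _ _
    have hm := mulInv_nonneg (mulInv_nonneg hY0)
    have e2 := neg_inner_negPart_le U.1 hm
    have e3 : 0 ≤ Y.1 - mulInv (mulInv Y.1) :=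
      sub_nonneg.2 ((mulInv_le_self (mulInv_nonneg hY0)).trans (mulInv_le_self hY0))
    have e4 := inner_nonneg_of_nonneg (negPart_nonneg U.1) e3
    rw [inner_sub_right] at e4
    linarith
  have h4 := real_inner_le_norm (Lp.negPart U.1) Y.1
  have h5 := mul_norm_negPart_sq (l + 1 / 2) hU
  have h6 : inner ℝ (transport U + (l + 1 / 2) • U.1) (Lp.negPart U.1) =
      inner ℝ a (Lp.negPart U.1) + inner ℝ F.1 (Lp.negPart U.1) := by
    rw [← inner_add_left, ha, sub_add_cancel]
  have h7 := inner_nonneg_of_nonneg hF0 (negPart_nonneg U.1)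
  have h8 := neg_inner_negPart_le a (negPart_nonneg U.1)
  have h9 := real_inner_le_norm (Lp.negPart a) (Lp.negPart U.1)
  rw [h6] at h5
  have hA : ‖Lp.negPart a‖ = 0 ∧ ‖Lp.negPart U.1‖ = 0 := by
    have n1 := norm_nonneg (Lp.negPart a)
    have n2 := norm_nonneg (Lp.negPart U.1)
    have n3 := norm_nonneg Y.1
    generalize ‖Lp.negPart a‖ = A at *
    generalize ‖Lp.negPart U.1‖ = B at *
    generalize ‖Y.1‖ = y at *
    -- Each of the two potential terms contributes at least `-(1/4) ‖u⁻‖ ‖Y‖`; for the second, `1/r²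
    -- ≤ 1` in the exterior.
    have i1 : A ^ 2 ≤ 1 / 2 * (B * y) := by linarith
    -- The assumption `l > 1/2` enters here and in `i5` through `l + 1/2 > 1`. With `A² ≤ A B / 2`
    -- and `B² ≤ A B`, the inequality `2 A B ≤ A² + B²` forces `A B = 0`.
    have i2 : y ≤ A := by nlinarith
    have i3 : B * y ≤ B * A := mul_le_mul_of_nonneg_left i2 n2
    have i4 : (l + 1 / 2) * B ^ 2 ≤ A * B := by linarith
    have i5 : B ^ 2 ≤ A * B := by nlinarith [sq_nonneg B]
    have i6 : A ^ 2 ≤ 0 := by nlinarith [sq_nonneg (A - B)]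
    have i7 : A = 0 := pow_eq_zero_iff two_ne_zero |>.1 (le_antisymm i6 (sq_nonneg _))
    refine ⟨i7, ?_⟩
    rw [i7, zero_mul] at i5
    exact pow_eq_zero_iff two_ne_zero |>.1 (le_antisymm i5 (sq_nonneg _))
  exact ⟨nonneg_of_negPart_eq_zero (norm_eq_zero.1 hA.2),
    nonneg_of_negPart_eq_zero (norm_eq_zero.1 hA.1)⟩

/-- The cone of radial states `(u, v)` with `u ≥ 0` and `v + ∂ᵣ u + u / (2 r) + u / 2 ≥ 0`. In terms
of `w = r^(1/2) exp (t/2) u` the last condition says `∂ₜ w + ∂ᵣ w ≥ 0`. -/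
def positiveCone : Set (EnergySpace exteriorDisc) :=
  {x | (∀ θ, compIsoPair (rot θ) x.1 = x.1) ∧ (∀ θ, compIso (rot θ) x.2 = x.2) ∧
    0 ≤ toL2 x.1 ∧ 0 ≤ x.2 + transport x.1 + (1 / 2 : ℝ) • toL2 x.1}

theorem continuous_toL2 : Continuous (toL2 : H10 exteriorDisc → L2 exteriorDisc) :=
  continuous_fst.comp continuous_subtype_val

theorem isClosed_positiveCone : IsClosed positiveCone := by
  have h1 : Continuous fun x : EnergySpace exteriorDisc =>
      (x.1 : L2 exteriorDisc × (Fin 2 → L2 exteriorDisc)) :=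
    continuous_subtype_val.comp continuous_fst
  have h2 : Continuous fun x : EnergySpace exteriorDisc => toL2 x.1 :=
    continuous_toL2.comp continuous_fst
  have h3 : Continuous fun x : EnergySpace exteriorDisc => transport x.1 :=
    transport.continuous.comp h1
  have e : positiveCone = (⋂ θ : ℝ, {x | compIsoPair (rot θ) x.1 = x.1}) ∩
      ((⋂ θ : ℝ, {x | compIso (rot θ) x.2 = x.2}) ∩ ({x | 0 ≤ toL2 x.1} ∩
        {x | 0 ≤ x.2 + transport x.1 + (1 / 2 : ℝ) • toL2 x.1})) := by
    ext x
    simp only [positiveCone, Set.mem_inter_iff, Set.mem_iInter, Set.mem_ofPred_eq]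
  rw [e]
  refine (isClosed_iInter fun θ => isClosed_eq ((continuous_compIsoPair _).comp h1) h1).inter
    ((isClosed_iInter fun θ => isClosed_eq ((compIso _).continuous.comp continuous_snd)
      continuous_snd).inter ((isClosed_le continuous_const h2).inter
        (isClosed_le continuous_const ((continuous_snd.add h3).add (h2.fun_const_smul _)))))

theorem compIsoPair_smul (R : E 2 ≃ₗᵢ[ℝ] E 2) (c : ℝ)
    (X : L2 exteriorDisc × (Fin 2 → L2 exteriorDisc)) :
    compIsoPair R (c • X) = c • compIsoPair R X := by
  refine Prod.ext ?_ (funext fun i => ?_)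
  · simp [compIsoPair]
  · simp only [compIsoPair, Prod.smul_snd, Pi.smul_apply, map_smul, Finset.smul_sum, smul_comm c]

theorem smul_L2_nonneg {c : ℝ} (hc : 0 ≤ c) {u : L2 exteriorDisc} (hu : 0 ≤ u) : 0 ≤ c • u := by
  rw [← Lp.coeFn_nonneg] at hu ⊢
  filter_upwards [hu, Lp.coeFn_smul c u] with x h1 h2
  rw [h2]
  exact mul_nonneg hc h1

theorem smul_mem_positiveCone {c : ℝ} (hc : 0 < c) {x : EnergySpace exteriorDisc}
    (hx : x ∈ positiveCone) : c • x ∈ positiveCone := by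
  obtain ⟨h1, h2, h3, h4⟩ := hx
  refine ⟨fun θ => ?_, fun θ => ?_, ?_, ?_⟩
  · change compIsoPair (rot θ) (c • (x.1 : L2 exteriorDisc × (Fin 2 → L2 exteriorDisc))) = _
    rw [compIsoPair_smul, h1]
    rfl
  · rw [Prod.smul_snd, map_smul, h2]
  · exact smul_L2_nonneg hc.le h3
  · have e : (c • x).2 + transport (c • x).1 + (1 / 2 : ℝ) • toL2 (c • x).1 =
        c • (x.2 + transport x.1 + (1 / 2 : ℝ) • toL2 x.1) := by
      have e1 : transport (c • x).1 = c • transport x.1 := map_smul transport c _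
      have e2 : toL2 (c • x).1 = c • toL2 x.1 := rfl
      rw [e1, e2, Prod.smul_snd]
      module
    rw [e]
    exact smul_L2_nonneg hc.le h4

/-- Eliminating `v = l u - f` gives `(l² + l) u - Δu = g + (l + 1) f` and identifies the second cone
quantity `v + D u + u/2` of `y` with `a = D u + (l + 1/2) u - f`. Symmetry follows from uniqueness
of the weak solution, and the two signs from `nonneg_of_weak_solution`. -/
theorem resolvent_mem_positiveCone {l : ℝ} (hl : 1 / 2 < l) {x y z : EnergySpace exteriorDisc}
    (hx : x ∈ positiveCone) (hyz : DampedWaveGraph exteriorDisc y z) (hxyz : l • y - z = x) :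
    y ∈ positiveCone := by
  obtain ⟨hx1, hx2, hx3, hx4⟩ := hx
  obtain ⟨hz, w, hw, hz2⟩ := hyz
  set U : L2 exteriorDisc × (Fin 2 → L2 exteriorDisc) := y.1.1 with hUdef
  set F : L2 exteriorDisc × (Fin 2 → L2 exteriorDisc) := x.1.1 with hFdef
  have hU : U ∈ H10 exteriorDisc := y.1.2
  have hF : F ∈ H10 exteriorDisc := x.1.2
  have hv : y.2 = l • U.1 - F.1 := by
    have e : F.1 = l • U.1 - toL2 z.1 := by rw [hFdef, ← hxyz]; rfl
    rw [e, ← hz]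
    abel
  have hwv : w = (l + 1) • y.2 - x.2 := by
    have e : x.2 = l • y.2 - z.2 := by rw [← hxyz]; rfl
    rw [e, hz2]
    module
  have hweak : ∀ Y ∈ H10 exteriorDisc, ∑ i, inner ℝ (U.2 i) (Y.2 i) +
      (l ^ 2 + l) * inner ℝ U.1 Y.1 = inner ℝ (x.2 + (l + 1) • F.1) Y.1 := by
    intro Y hY
    rw [IsH2WithLaplacian.sum_inner isOpen_exteriorDisc hU hw hY, hwv, hv]
    simp only [inner_add_left, inner_sub_left, inner_smul_left, conj_trivial]
    ring
  have hF1 : ∀ θ, compIso (rot θ) F.1 = F.1 := fun θ => congrArg Prod.fst (hx1 θ)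
  have hUinv : ∀ θ, compIsoPair (rot θ) U = U := fun θ =>
    compIsoPair_eq_of_weak_solution (rot θ) hU (by positivity)
      (by rw [map_add, map_smul, hx2, hF1]) hweak
  have hU1 : ∀ θ, compIso (rot θ) U.1 = U.1 := fun θ => congrArg Prod.fst (hUinv θ)
  have hinv : transport U + (l + 1 / 2) • U.1 - F.1 ∈ rotInvariant := by
    refine mem_rotInvariant.2 fun θ => ?_
    rw [map_sub, map_add, map_smul, ← transport_compIsoPair, hUinv, hU1, hF1]
  obtain ⟨h1, h2⟩ := nonneg_of_weak_solution hU hF hl hweak hinv hx3 hx4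
  refine ⟨hUinv, fun θ => ?_, h1, ?_⟩
  · rw [hv, map_sub, map_smul, hU1, hF1]
  · have e : y.2 + transport y.1 + (1 / 2 : ℝ) • toL2 y.1 =
        transport U + (l + 1 / 2) • U.1 - F.1 := by
      rw [hv]
      change l • U.1 - F.1 + transport U + (1 / 2 : ℝ) • U.1 = _
      module
    rw [e]
    exact h2

theorem zero_prod_mem_positiveCone {g : L2 exteriorDisc} (hg : IsRadial g) (hg0 : 0 ≤ g) :
    ((0, g) : EnergySpace exteriorDisc) ∈ positiveCone := by
  have h0 : ∀ R, compIsoPair R 0 = 0 := fun R => by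
    simpa using compIsoPair_smul R 0 0
  refine ⟨fun θ => h0 _, fun θ => hg.compIso_eq _, le_rfl, ?_⟩
  have e : g + transport ((0 : H10 exteriorDisc) : L2 exteriorDisc × (Fin 2 → L2 exteriorDisc)) +
      (1 / 2 : ℝ) • toL2 (0 : H10 exteriorDisc) = g := by
    have e1 : toL2 (0 : H10 exteriorDisc) = 0 := rfl
    rw [e1, Submodule.coe_zero, map_zero, smul_zero, add_zero, add_zero]
  change 0 ≤ g + _ + _
  rw [e]
  exact hg0

end Cone

end DampedWave

end

theorem proposition3p2
    (T : ℝ≥0 → DampedWave.EnergySpace DampedWave.exteriorDisc →L[ℝ]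
      DampedWave.EnergySpace DampedWave.exteriorDisc)
    (hT : DampedWave.IsC0Semigroup T)
    (hgen : DampedWave.IsGeneratedBy T (DampedWave.DampedWaveGraph DampedWave.exteriorDisc))
    (g : DampedWave.L2 DampedWave.exteriorDisc)
    (hg_rad : DampedWave.IsRadial g)
    (hg_nonneg : ∀ᵐ x ∂(volume.restrict DampedWave.exteriorDisc), 0 ≤ g x)
    (t : ℝ≥0) (ht : 0 < t) :
    DampedWave.IsRadial (DampedWave.solutionMap T t g) ∧
      ∀ᵐ x ∂(volume.restrict DampedWave.exteriorDisc), 0 ≤ DampedWave.solutionMap T t g x := by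
  obtain ⟨h1, -, h3, -⟩ := hT.mem_of_resolvent_mem hgen DampedWave.isClosed_positiveCone
    (fun _ ha _ hx => DampedWave.smul_mem_positiveCone ha hx)
    (fun _ hl _ hx _ _ hyz hxyz => DampedWave.resolvent_mem_positiveCone hl hx hyz hxyz) t
    (DampedWave.zero_prod_mem_positiveCone hg_rad ((Lp.coeFn_nonneg g).1 hg_nonneg))
  exact ⟨DampedWave.isRadial_of_rot_invariant fun θ => congrArg Prod.fst (h1 θ),
    (Lp.coeFn_nonneg _).2 h3⟩
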